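/- Consider the following two models, each with an integer parameter $\delta$ (the conformal mass), a frequency sequence $\omega_n$, a function $W$, a measure $d\mu(x)=w(x)\,dx$ on $(0,\pi/2)$ and functions $e_n$, $n\ge 0$, that form an orthonormal system in $L^2((0,\pi/2);d\mu)$. Here $P_n^{(a,b)}$ denotes the Jacobi polynomials. Klein--Gordon model (KG), $\delta\ge 2$: $\omega_n=2n+\delta$, $W(x)=\cos^{2\delta-2}x$, $w(x)=\sin^2x\cos^{2\delta-2}x$, and $$e_n(x)=\sqrt{\frac{2\,\Gamma(n+1)}{\Gamma(n+\frac32)}\,\frac{(2n+\delta)\,\Gamma(n+\delta)}{\Gamma(n+\delta-\frac12)}}\;P_n^{(\frac12,\,\delta-\frac32)}(\cos 2x).$$ Wave maps model (WM), $\delta\ge 1$: $\omega_n=2n+\delta+2$, $W(x)=\sin^{2\delta-2}x\cos^4x$, $w(x)=\sin^{2\delta+1}x\cos^3x$, and $$e_n(x)=\sqrt{\frac{2(\delta+n+1)(\delta+2n+2)}{n+1}}\;P_n^{(\delta,1)}(\cos 2x).$$ In each model put $$C_{ijkm}=\int_0^{\pi/2}W(x)\,e_i(x)e_j(x)e_k(x)e_m(x)\,d\mu(x).$$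 (1) In the KG model for every integer $\delta\ge 2$, and in the WM model for every integer $\delta\ge 1$, $$\frac{C_{0000}}{\omega_0^2}-2\,\frac{C_{00mm}}{\omega_m^2}\neq 0\qquad\text{for all integers } m\ge 1.$$ (2) In the KG model with an integer $\delta\ge 2$, these quantities are positive for all $m\ge1$ if and only if $\delta\in\{2,\dots,9\}$. In the WM model they are positive for all $m\ge 1$, for every integer $\delta\ge 1$. (3) In the KG model with $\delta\in\{2,\dots,9\}$, and in the WM model with any integer $\delta\ge1$, the minimum over $m\ge 1$ exists and there is a constant $c_\perp(\delta)>0$, depending only on $\delta$ (and on the model), such that $$\min_{m\ge 1}\left(\frac{C_{0000}}{\omega_0^2}-2\,\frac{C_{00mm}}{\omega_m^2}\right)\ \ge\ c_\perp(\delta).$$ -/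

import Mathlib

namespace AdS

noncomputable section

/-- The two models: the Klein-Gordon equation and co-rotational wave maps on AdS. -/
inductive Model where
  | KG
  | WM

/-- The admissible conformal masses: integers `δ ≥ 2` for KG and integers `δ ≥ 1` for WM. -/
def Model.Admissible : Model → ℕ → Prop
  | .KG, δ => 2 ≤ δ
  | .WM, δ => 1 ≤ δ

/-- The Jacobi polynomial `P_n^{(a,b)}(y)`, through its expansion at `y = 1`:
`∑_{k ≤ n} (n+a+b+1)_k (a+k+1)_{n-k} / (k! (n-k)!) ((y-1)/2)^k`,
where `(x)_k = x (x+1) ⋯ (x+k-1)`. -/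
def jacobiP (n : ℕ) (a b y : ℝ) : ℝ :=
  ∑ k ∈ Finset.range (n + 1),
    (ascPochhammer ℝ k).eval (n + a + b + 1) * (ascPochhammer ℝ (n - k)).eval (a + k + 1)
      / ((k.factorial : ℝ) * ((n - k).factorial : ℝ)) * ((y - 1) / 2) ^ k

/-- The frequencies `ω_n`; the eigenvalues of the linearized operator are the `ω_n ^ 2`. -/
def Model.omega : Model → ℕ → ℕ → ℝ
  | .KG, δ, n => 2 * n + δ
  | .WM, δ, n => 2 * n + δ + 2

/-- The normalization constants `N_n`. -/
def Model.normConst : Model → ℕ → ℕ → ℝ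
  | .KG, δ, n =>
      √(2 * Real.Gamma (n + 1) / Real.Gamma (n + 3 / 2) *
        ((2 * n + δ) * Real.Gamma (n + δ) / Real.Gamma (n + δ - 1 / 2)))
  | .WM, δ, n => √(2 * (δ + n + 1) * (δ + 2 * n + 2) / (n + 1))

/-- The eigenfunctions `e_n(x)` of the linearized operator. -/
def Model.eigenfun : Model → ℕ → ℕ → ℝ → ℝ
  | .KG, δ, n, x => Model.normConst .KG δ n * jacobiP n (1 / 2) (δ - 3 / 2) (Real.cos (2 * x))
  | .WM, δ, n, x => Model.normConst .WM δ n * jacobiP n δ 1 (Real.cos (2 * x))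

/-- The density `w` of the measure `dμ = w(x) dx` on `(0, π/2)`. The exponent is a subtraction of
natural numbers; it does not truncate, since `δ ≥ 1`. -/
def Model.weight : Model → ℕ → ℝ → ℝ
  | .KG, δ, x => Real.sin x ^ 2 * Real.cos x ^ (2 * δ - 2)
  | .WM, δ, x => Real.sin x ^ (2 * δ + 1) * Real.cos x ^ 3

/-- The coefficient `W` of the cubic nonlinearity `W φ³`. The exponents are subtractions of natural
numbers; they do not truncate, since `δ ≥ 1`. -/
def Model.nonlinWeight : Model → ℕ → ℝ → ℝ
  | .KG, δ, x => Real.cos x ^ (2 * δ - 2)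
  | .WM, δ, x => Real.sin x ^ (2 * δ - 2) * Real.cos x ^ 4

/-- The inner product `(f|g) = ∫_0^{π/2} f(x) g(x) dμ(x)`, `dμ(x) = w(x) dx`. -/
def Model.inner (M : Model) (δ : ℕ) (f g : ℝ → ℝ) : ℝ :=
  ∫ x in (0 : ℝ)..(Real.pi / 2), f x * g x * M.weight δ x

/-- The Fourier coefficients `C_{ijkm} = (W e_i e_j e_k | e_m)`. -/
def Model.fourierCoeff (M : Model) (δ i j k m : ℕ) : ℝ :=
  M.inner δ
    (fun x => M.nonlinWeight δ x * M.eigenfun δ i x * M.eigenfun δ j x * M.eigenfun δ k x)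
    (M.eigenfun δ m)

/-- The quantity `C_{0000}/ω_0² - 2 C_{00mm}/ω_m²`. -/
def Model.gap (M : Model) (δ m : ℕ) : ℝ :=
  M.fourierCoeff δ 0 0 0 0 / M.omega δ 0 ^ 2 - 2 * (M.fourierCoeff δ 0 0 m m / M.omega δ m ^ 2)

/-- The set `{C_{0000}/ω_0² - 2 C_{00mm}/ω_m² : m ≥ 1}`. -/
def Model.gapSet (M : Model) (δ : ℕ) : Set ℝ :=
  {r | ∃ m : ℕ, 1 ≤ m ∧ r = M.gap δ m}

/-- The assumption on the conformal mass for stability: `δ ∈ {2, …, 9}` for KG; for WM it adds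
nothing to admissibility. -/
def Model.StableMass : Model → ℕ → Prop
  | .KG, δ => 2 ≤ δ ∧ δ ≤ 9
  | .WM, δ => 1 ≤ δ

end

end AdS

/-!
In the variable `t = sin² x` the eigenfunctions are multiples of Jacobi polynomials `P_m`, the
measure `dμ` is a multiple of `t^a (1-t)^b dt`, and `W` is a polynomial in `t`. Let `A_m` be the
average of `W` in the probability measure proportional to `e_m² dμ`. As `e_0` is constant and the
norms of the `e_m` agree, `C_{0000}/ω_0² - 2 C_{00mm}/ω_m²` is a positive multiple of
`A_0 ω_m² - 2 A_m ω_0²` (`Model.gap_eq_mul_sub`), and the task is to compare `A_m` with `A_0`.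

Two identities are used, both consequences of integration by parts and of the Jacobi differential
equation. The moment identity `IsJacobiFunctional.map_momentKernel` is the third-order equation of
`P_m²` in weak form; it yields three-term recurrences between the moments of `P_m²`. The raising
identity `IsJacobiFunctional.map_raiseKernel` expresses moments of `P_{m+1}²` by moments of `P_m²`;
it also yields the norms.

In the Klein--Gordon model `a = 1/2` and `W = (1-t)^{δ-1}`. The recurrence of the moments of `1 - t`
is solved by a sum of products with nonnegative factors that are nonincreasing in `ω_m²`
(`newtonSum`), so `A_m` is nonincreasing in `m`. The claim for `m ≥ 2` follows from the inequality
for `m = 2`, which is strict for every `δ ≥ 2` (`Model.average_KG_two_lt`). For `m = 1` the gap is a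
positive multiple of `10 δ² - δ³ - 2` (`Model.gap_KG_one`), which is positive for `2 ≤ δ ≤ 9` and
negative for `δ ≥ 10`.

In the wave maps model `a = δ`, `b = 1` and `W = t^{δ-1} (1-t)²`. The exponent `δ = a` is special for
the moment recurrence, and modulo moment identities the span of `W` and `t^δ` is stable under
raising: `A_{m+1}` is a combination, with explicit positive coefficients, of `A_m` and of the average
of `t^δ`, while the average of `t^δ` obeys a recurrence of first order. The inequality
`2 A_m ω_0² < A_0 ω_m²` is then proved by induction on `m ≥ 1` (`two_mul_lt_of_recurrence`).

Finally `0 ≤ W ≤ 1` gives `0 ≤ A_m ≤ 1`, so the gaps tend to a limit; it exceeds the gap at `m = 1`,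
hence the minimum over `m ≥ 1` is attained.
-/

namespace AdS

noncomputable section

open Polynomial

/-! ### Jacobi polynomials in the variable `t = sin² x` -/

/-- The Jacobi polynomial `P_n^{(a,b)}(1 - 2t)` as a polynomial in `t`. With `t = sin² x` one has
`1 - 2t = cos 2x`. -/
def jacobiPoly (n : ℕ) (a b : ℝ) : ℝ[X] :=
  ∑ k ∈ Finset.range (n + 1),
    C ((-1) ^ k * ((ascPochhammer ℝ k).eval (n + a + b + 1)
      * (ascPochhammer ℝ (n - k)).eval (a + k + 1)
      / ((k.factorial : ℝ) * ((n - k).factorial : ℝ)))) * X ^ k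

theorem eval_jacobiPoly (n : ℕ) (a b y : ℝ) :
    (jacobiPoly n a b).eval ((1 - y) / 2) = jacobiP n a b y := by
  rw [jacobiPoly, eval_finsetSum, jacobiP]
  refine Finset.sum_congr rfl fun k _ => ?_
  rw [show (y - 1) / 2 = -1 * ((1 - y) / 2) by ring, mul_pow]
  simp only [eval_mul, eval_C, eval_pow, eval_X]
  ring

theorem coeff_jacobiPoly (n : ℕ) (a b : ℝ) (k : ℕ) :
    (jacobiPoly n a b).coeff k = if k ≤ n then
      (-1) ^ k * ((ascPochhammer ℝ k).eval (n + a + b + 1)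
      * (ascPochhammer ℝ (n - k)).eval (a + k + 1)
      / ((k.factorial : ℝ) * ((n - k).factorial : ℝ))) else 0 := by
  rw [jacobiPoly, finsetSum_coeff]
  simp only [coeff_C_mul_X_pow, Finset.sum_ite_eq, Finset.mem_range, Nat.lt_succ_iff]

/-- Both sides vanish for `k ≥ n`, so the recurrence holds for all `k`. -/
theorem coeff_jacobiPoly_succ (n : ℕ) (a b : ℝ) (k : ℕ) :
    ((k : ℝ) + 1) * (k + 1 + a) * (jacobiPoly n a b).coeff (k + 1)
      = ((k : ℝ) - n) * (k + n + (a + b + 1)) * (jacobiPoly n a b).coeff k := by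
  rcases lt_trichotomy k n with h | rfl | h
  · obtain ⟨j, rfl⟩ := Nat.exists_eq_add_of_lt h
    rw [coeff_jacobiPoly, coeff_jacobiPoly, if_pos (by omega), if_pos (by omega),
      show k + j + 1 - k = j + 1 by omega, show k + j + 1 - (k + 1) = j by omega,
      ascPochhammer_succ_eval, ascPochhammer_succ_left, Nat.factorial_succ, Nat.factorial_succ]
    simp only [eval_mul, eval_X, eval_comp, eval_add, eval_one]
    push_cast
    rw [show a + (k : ℝ) + 1 + 1 = a + (k + 1) + 1 by ring]
    have := Nat.factorial_ne_zero k
    have := Nat.factorial_ne_zero j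
    field_simp
    ring
  · simp [coeff_jacobiPoly]
  · simp [coeff_jacobiPoly, show ¬ k ≤ n by omega, show ¬ k + 1 ≤ n by omega]

theorem coeff_jacobiPoly_zero (n : ℕ) (a b : ℝ) :
    (jacobiPoly n a b).coeff 0 = (ascPochhammer ℝ n).eval (a + 1) / n.factorial := by
  simp [coeff_jacobiPoly]

/-- The Jacobi differential equation in the variable `t`. -/
theorem jacobiPoly_ode (n : ℕ) (a b : ℝ) :
    X * (1 - X) * derivative (derivative (jacobiPoly n a b))
      + (C (a + 1) - C (a + b + 2) * X) * derivative (jacobiPoly n a b)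
      + C (n * (n + (a + b + 1))) * jacobiPoly n a b = 0 := by
  ext k
  rw [show X * (1 - X) * derivative (derivative (jacobiPoly n a b))
      + (C (a + 1) - C (a + b + 2) * X) * derivative (jacobiPoly n a b)
      + C (n * (n + (a + b + 1))) * jacobiPoly n a b
      = derivative (derivative (jacobiPoly n a b)) * X
      - derivative (derivative (jacobiPoly n a b)) * X * X
      + C (a + 1) * derivative (jacobiPoly n a b)
      - C (a + b + 2) * (derivative (jacobiPoly n a b) * X)
      + C (n * (n + (a + b + 1))) * jacobiPoly n a b by ring]
  have h := coeff_jacobiPoly_succ n a b k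
  rcases k with _ | _ | k <;>
    simp only [coeff_add, coeff_sub, coeff_C_mul, coeff_mul_X, coeff_mul_X_zero, coeff_derivative,
      coeff_zero] <;> push_cast at h ⊢ <;> linear_combination h

/-- The raising relation, which expresses `P_{n+1}` through `P_n` and its derivative. The coefficients
of the right-hand side satisfy the recurrence `coeff_jacobiPoly_succ` of `P_{n+1}`; as `a > -1`,
that recurrence determines a polynomial from its constant term. -/
theorem jacobiPoly_succ (n : ℕ) (a b : ℝ) (ha : -1 < a) :
    C (((n : ℝ) + 1) * (n + (a + b + 1))) * jacobiPoly (n + 1) a b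
      = C (2 * n + a + b + 2) * (X * (1 - X)) * derivative (jacobiPoly n a b)
        - (C (-(n + (a + b + 1)) * (n + a + 1)) + C ((n + (a + b + 1)) * (2 * n + a + b + 2)) * X)
          * jacobiPoly n a b := by
  have key : ∀ k, (C (2 * n + a + b + 2) * (X * (1 - X)) * derivative (jacobiPoly n a b)
        - (C (-(n + (a + b + 1)) * (n + a + 1)) + C ((n + (a + b + 1)) * (2 * n + a + b + 2)) * X)
          * jacobiPoly n a b).coeff k =
      ((n + (a + b + 1)) * (n + a + 1) + (2 * n + a + b + 2) * k) * (jacobiPoly n a b).coeff k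
       - (2 * n + a + b + 2) * (k - 1 + n + (a + b + 1)) * (jacobiPoly n a b * X).coeff k := by
    intro k
    rw [show C (2 * n + a + b + 2) * (X * (1 - X)) * derivative (jacobiPoly n a b)
        - (C (-(n + (a + b + 1)) * (n + a + 1)) + C ((n + (a + b + 1)) * (2 * n + a + b + 2)) * X)
          * jacobiPoly n a b
        = C (2 * n + a + b + 2) * (derivative (jacobiPoly n a b) * X)
        - C (2 * n + a + b + 2) * (derivative (jacobiPoly n a b) * X * X)
        - C (-(n + (a + b + 1)) * (n + a + 1)) * jacobiPoly n a b
        - C ((n + (a + b + 1)) * (2 * n + a + b + 2)) * (jacobiPoly n a b * X) by ring]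
    rcases k with _ | _ | k <;>
      simp only [coeff_sub, coeff_C_mul, coeff_mul_X, coeff_mul_X_zero, coeff_derivative] <;>
      push_cast <;> ring
  ext k
  rw [key]
  induction k with
  | zero =>
    have : ((n : ℝ) + 1) ≠ 0 := by positivity
    have := Nat.factorial_ne_zero n
    simp only [coeff_mul_X_zero, coeff_C_mul, coeff_jacobiPoly_zero, ascPochhammer_succ_eval,
      Nat.factorial_succ]
    push_cast
    field_simp
    ring
  | succ k ih =>
    have h1 := coeff_jacobiPoly_succ n a b k
    have h2 := coeff_jacobiPoly_succ (n + 1) a b k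
    have h0 : (k : ℝ) * (k + a) * (jacobiPoly n a b).coeff k
      = ((k : ℝ) - 1 - n) * (k - 1 + n + (a + b + 1)) * (jacobiPoly n a b * X).coeff k := by
      rcases k with _ | k
      · simp
      · have := coeff_jacobiPoly_succ n a b k
        rw [coeff_mul_X]; push_cast; linear_combination this
    have hk : ((k : ℝ) + 1) * (k + 1 + a) ≠ 0 := by
      have : (0 : ℝ) ≤ k := by positivity
      have : 0 < (k : ℝ) + 1 + a := by linarith
      positivity
    rw [coeff_C_mul] at ih ⊢
    rw [coeff_mul_X]
    refine mul_left_cancel₀ hk ?_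
    push_cast at h2 ⊢
    linear_combination (((n : ℝ) + 1) * (n + (a + b + 1))) * h2
      + (((k : ℝ) - (n + 1)) * (k + (n + 1) + (a + b + 1))) * ih
      - ((n + (a + b + 1)) * (n + a + 1) + (2 * n + a + b + 2) * (k + 1)) * h1
      + ((2 * n + a + b + 2) * (k + (n + 1) + (a + b + 1))) * h0

/-! ### The moment identity and the raising identity -/

/-- A linear functional `Λ` on polynomials which satisfies the Pearson equation of the weight
`t^a (1-t)^b`, that is, integration by parts against `t^{a+1} (1-t)^{b+1}` without boundary terms.
This is all that the algebraic part of the argument uses of the integral. -/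
def IsJacobiFunctional (a b : ℝ) (Λ : ℝ[X] →ₗ[ℝ] ℝ) : Prop :=
  ∀ f : ℝ[X], Λ (X * (1 - X) * derivative f + (C (a + 1) - C (a + b + 2) * X) * f) = 0

/-- The coefficient `β = (e - w') g - w g'`, where `w = t(1-t)` and `e = (a+1) - (a+b+2)t`. -/
def momentBeta (a b : ℝ) (g : ℝ[X]) : ℝ[X] :=
  (C (a + 1) - C (a + b + 2) * X - (1 - 2 * X)) * g - X * (1 - X) * derivative g

/-- The coefficient `α = 2 λ g - β'`, where `λ = m(m+a+b+1)` is the eigenvalue of `P_m`. -/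
def momentAlpha (m : ℕ) (a b : ℝ) (g : ℝ[X]) : ℝ[X] :=
  2 * C (m * (m + (a + b + 1))) * g - derivative (momentBeta a b g)

/-- The polynomial `w α' + e α - 2 λ β`, linear in the test polynomial `g`. It is the adjoint of the
third-order differential equation satisfied by `P_m²`. -/
def momentKernel (m : ℕ) (a b : ℝ) (g : ℝ[X]) : ℝ[X] :=
  X * (1 - X) * derivative (momentAlpha m a b g)
    + (C (a + 1) - C (a + b + 2) * X) * momentAlpha m a b g
    - 2 * C (m * (m + (a + b + 1))) * momentBeta a b g

/-- The Pearson equation applied to `α P² + 2 β P P' + 2 w g P'²`: the choice of `α` and `β` removes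
the terms in `P P'` and `P'²`, once `P''` is eliminated by the differential equation. -/
theorem IsJacobiFunctional.map_momentKernel {a b : ℝ} {Λ : ℝ[X] →ₗ[ℝ] ℝ}
    (hΛ : IsJacobiFunctional a b Λ) (m : ℕ) (g : ℝ[X]) :
    Λ (jacobiPoly m a b ^ 2 * momentKernel m a b g) = 0 := by
  have ode := jacobiPoly_ode m a b
  have hα : momentAlpha m a b g = 2 * C (m * (m + (a + b + 1))) * g
    - derivative (momentBeta a b g) := rfl
  have hβ : momentBeta a b g = (C (a + 1) - C (a + b + 2) * X - (1 - 2 * X)) * g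
    - X * (1 - X) * derivative g := rfl
  rw [← hΛ (momentAlpha m a b g * jacobiPoly m a b ^ 2
    + 2 * momentBeta a b g * jacobiPoly m a b * derivative (jacobiPoly m a b)
    + 2 * (X * (1 - X)) * g * derivative (jacobiPoly m a b) ^ 2), momentKernel]
  congr 1
  generalize jacobiPoly m a b = P at *
  generalize momentBeta a b g = β at *
  generalize momentAlpha m a b g = α at *
  simp only [derivative_add, derivative_mul, derivative_sub, derivative_pow, derivative_X,
    derivative_one, derivative_ofNat]
  generalize C (a + 1) - C (a + b + 2) * X = e at *
  generalize C (m * (m + (a + b + 1))) = l at *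
  simp only [Nat.cast_ofNat, map_ofNat, Nat.add_one_sub_one, pow_one]
  linear_combination
    (-2 * P * β - 4 * (X * (1 - X)) * g * derivative P) * ode
    - 2 * X * (1 - X) * P * derivative P * hα
    - 2 * X * (1 - X) * derivative P ^ 2 * hβ

/-- The coefficient `l` in the raising relation `(m+1)(m+a+b+1) P_{m+1} = τ w P_m' - l P_m`, where
`τ = 2m+a+b+2`. -/
def raiseLin (m : ℕ) (a b : ℝ) : ℝ[X] :=
  C (-(m + (a + b + 1)) * (m + a + 1)) + C ((m + (a + b + 1)) * (2 * m + a + b + 2)) * X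

/-- The coefficient `β = -τ² w f`. -/
def raiseBeta (m : ℕ) (a b : ℝ) (f : ℝ[X]) : ℝ[X] :=
  -C (2 * m + a + b + 2) ^ 2 * (X * (1 - X)) * f

/-- The coefficient `α = 2 τ l f - β'`. -/
def raiseAlpha (m : ℕ) (a b : ℝ) (f : ℝ[X]) : ℝ[X] :=
  2 * C (2 * m + a + b + 2) * raiseLin m a b * f - derivative (raiseBeta m a b f)

/-- The polynomial `2 l² f + w α' + e α - 2 λ β`, through which moments of `P_{m+1}²` are expressed by
moments of `P_m²`. -/
def raiseKernel (m : ℕ) (a b : ℝ) (f : ℝ[X]) : ℝ[X] :=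
  2 * raiseLin m a b ^ 2 * f + X * (1 - X) * derivative (raiseAlpha m a b f)
    + (C (a + 1) - C (a + b + 2) * X) * raiseAlpha m a b f
    - 2 * C (m * (m + (a + b + 1))) * raiseBeta m a b f

theorem map_C_mul (Λ : ℝ[X] →ₗ[ℝ] ℝ) (c : ℝ) (f : ℝ[X]) : Λ (C c * f) = c * Λ f := by
  rw [C_mul', map_smul, smul_eq_mul]

/-- Square the raising relation and add the Pearson equation of `α P² + 2 β P P'`: the terms in `P P'`
and `P'²` cancel. -/
theorem IsJacobiFunctional.map_raiseKernel {a b : ℝ} (ha : -1 < a) {Λ : ℝ[X] →ₗ[ℝ] ℝ}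
    (hΛ : IsJacobiFunctional a b Λ) (m : ℕ) (f : ℝ[X]) :
    2 * (((m : ℝ) + 1) * (m + (a + b + 1))) ^ 2 * Λ (jacobiPoly (m + 1) a b ^ 2 * f)
      = Λ (jacobiPoly m a b ^ 2 * raiseKernel m a b f) := by
  have ode := jacobiPoly_ode m a b
  have raise := jacobiPoly_succ m a b ha
  have hα : raiseAlpha m a b f = 2 * C (2 * m + a + b + 2) * raiseLin m a b * f
    - derivative (raiseBeta m a b f) := rfl
  have hβ : raiseBeta m a b f = -C (2 * m + a + b + 2) ^ 2 * (X * (1 - X)) * f := rfl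
  have hl : raiseLin m a b = C (-(m + (a + b + 1)) * (m + a + 1))
    + C ((m + (a + b + 1)) * (2 * m + a + b + 2)) * X := rfl
  rw [← hl] at raise
  have h0 := hΛ (raiseAlpha m a b f * jacobiPoly m a b ^ 2
    + 2 * raiseBeta m a b f * jacobiPoly m a b * derivative (jacobiPoly m a b))
  rw [← map_C_mul, ← add_zero (Λ (C _ * _)), ← h0, ← map_add, raiseKernel]
  congr 1
  rw [C_mul, C_pow]
  generalize jacobiPoly m a b = P at *
  generalize jacobiPoly (m + 1) a b = Q at *
  generalize raiseBeta m a b f = β at *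
  generalize raiseAlpha m a b f = α at *
  generalize raiseLin m a b = l at *
  simp only [derivative_add, derivative_mul, derivative_pow,
    derivative_ofNat]
  generalize C (a + 1) - C (a + b + 2) * X = e at *
  generalize C (m * (m + (a + b + 1))) = lam at *
  generalize C (2 * m + a + b + 2) = τ at *
  generalize C (((m : ℝ) + 1) * (m + (a + b + 1))) = x at *
  simp only [Nat.cast_ofNat, map_ofNat, Nat.add_one_sub_one, pow_one]
  linear_combination (2 * P * β) * ode
    + 2 * f * (x * Q + (τ * (X * (1 - X)) * derivative P - l * P)) * raise
    + 2 * X * (1 - X) * P * derivative P * hα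
    + 2 * X * (1 - X) * derivative P ^ 2 * hβ

/-! ### Explicit kernels -/

/-- For `f = 1` the raising kernel is a constant modulo moment kernels; this gives the ratio of
consecutive norms. -/
theorem raiseKernel_one (m : ℕ) (a b : ℝ) :
    C (2 * m + a + b + 3) * raiseKernel m a b 1
      = C (2 * ((m + 1) * (m + a + 1) * (m + b + 1) * (m + (a + b + 1)) * (2 * m + (a + b + 1))))
        + momentKernel m a b
          (C (-(a * b + 2 * a * m + 2 * a + b ^ 2 + 2 * b * m + 2 * b + 2 * m ^ 2 + 4 * m + 2))
            + C ((2 * m + a + b + 2) ^ 2) * X) := by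
  refine Polynomial.funext fun x => ?_
  simp only [momentKernel, momentAlpha, momentBeta, raiseKernel, raiseAlpha, raiseBeta, raiseLin,
    derivative_add, derivative_sub, derivative_neg, derivative_mul, derivative_pow, derivative_X,
    derivative_C, derivative_one, derivative_ofNat, derivative_zero, eval_add, eval_sub, eval_mul,
    eval_pow, eval_neg, eval_X, eval_C, eval_one, eval_zero, eval_ofNat]
  ring

/-- For `b = 1` and `f = t^d` with `d = a`, the raising kernel is a multiple of `t^d` modulo moment
kernels. This depends on the factor `a² - ν²`, by which `momentKernel` of `t^ν` misses the power
`t^{ν-1}` when `ν = a`. -/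
theorem raiseKernel_X_pow (m n : ℕ) (d : ℝ) (hd : d = n + 1) :
    C ((m + d + 2) * (2 * d + 2 * m + 3)) * raiseKernel m d 1 (X ^ (n + 1))
      = C (2 * ((m + 1) * (m + d + 1) ^ 2 * (m + d + 2) ^ 2 * (2 * m + 3))) * X ^ (n + 1)
        + momentKernel m d 1 (X ^ (n + 1) *
          (C (-((2 * m + d + 3) * (d * m + 3 / 2 * d + m ^ 2 + 3 * m + 5 / 2)))
            + C ((2 * m + d + 3) ^ 2 * (2 * d + 2 * m + 3) / 2) * X)) := by
  refine Polynomial.funext fun x => ?_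
  simp only [momentKernel, momentAlpha, momentBeta, raiseKernel, raiseAlpha, raiseBeta, raiseLin,
    derivative_add, derivative_sub, derivative_neg, derivative_mul, derivative_X,
    derivative_C, derivative_one, derivative_ofNat, derivative_zero, eval_add, eval_sub, eval_mul,
    eval_pow, eval_neg, eval_X, eval_C, eval_one, eval_zero, eval_ofNat, Nat.add_one_sub_one,
    derivative_pow]
  subst hd
  rcases n with _ | _ | n
  · simp
    ring
  · simp
    ring
  · simp only [Nat.add_one_sub_one]
    push_cast
    ring

/-- For `b = 1` and `f = t^{d-1} (1-t)²` with `d = a`, the raising kernel lies in the span of `f` and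
`t^d` modulo moment kernels. -/
theorem raiseKernel_weight (m n : ℕ) (d : ℝ) (hd : d = n + 1) :
    C ((d + 1) * (m + d + 2) * (2 * m + 1) * (2 * d + 2 * m + 3) * (2 * d + 2 * m + 5))
        * raiseKernel m d 1 (X ^ n * (1 - X) ^ 2)
      = C (2 * ((d + 1) * (m + d + 2) * (2 * m + 1) * (2 * d + 2 * m + 3) * (2 * d + 2 * m + 5)
            * ((m + 1) ^ 2 * (m + 2) ^ 2))) * (X ^ n * (1 - X) ^ 2)
        + C (2 * ((m + 1) * (m + 2) * (m + d + 1) * (m + d + 2) * (2 * m + d + 3)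
            * (3 * ((2 * m + 1) * d + 2 * m ^ 2 + 6 * m + 3)))) * X ^ (n + 1)
        + momentKernel m d 1 (X ^ (n + 1) * C (2 * m + d + 3) *
          (C (4*d^4*m + 2*d^4 + 20*d^3*m^2 + 50*d^3*m + 20*d^3 + 28*d^2*m^3 + 142*d^2*m^2
              + 203*d^2*m + 139/2*d^2 + 12*d*m^4 + 112*d*m^3 + 324*d*m^2 + 351*d*m + 110*d
              + 18*m^4 + 114*m^3 + 256*m^2 + 236*m + 141/2)
            + C ((2 * m + 1) * (2 * d + 2 * m + 3) * (d + 1)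
              * (-2*d^2 - 7*d*m - 25/2*d - 5*m^2 - 19*m - 35/2)) * X
            + C ((2 * m + 1) * (2 * d + 2 * m + 3) * (d + 1) * (2 * m + d + 3) * (m + d + 2))
              * X ^ 2)) := by
  refine Polynomial.funext fun x => ?_
  simp only [momentKernel, momentAlpha, momentBeta, raiseKernel, raiseAlpha, raiseBeta, raiseLin,
    derivative_add, derivative_sub, derivative_neg, derivative_mul, derivative_X,
    derivative_C, derivative_one, derivative_ofNat, derivative_zero, eval_add, eval_sub, eval_mul,
    eval_pow, eval_neg, eval_X, eval_C, eval_one, eval_zero, eval_ofNat, Nat.add_one_sub_one,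
    derivative_pow]
  subst hd
  rcases n with _ | _ | n
  · simp
    ring
  · simp
    ring
  · simp only [Nat.add_one_sub_one]
    push_cast
    ring

/-- The three-term recurrence between consecutive moments of `1 - t`. The truncated exponent `ν - 1` at
`ν = 0` comes with a zero coefficient. -/
theorem momentKernel_one_sub_X_pow (m ν : ℕ) (a b : ℝ) :
    momentKernel m a b ((1 - X) ^ ν)
      = C ((ν + 1) * ((2 * m + a + b + 1) ^ 2 - (ν + 1) ^ 2)) * (1 - X) ^ (ν + 1)
        - C ((ν + 1 / 2) * ((2 * m + a + b + 1) ^ 2 + b ^ 2 - a ^ 2 - (ν + 1) ^ 2 - ν ^ 2))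
          * (1 - X) ^ ν
        + C (ν * (b ^ 2 - ν ^ 2)) * (1 - X) ^ (ν - 1) := by
  refine Polynomial.funext fun x => ?_
  simp only [momentKernel, momentAlpha, momentBeta,
    derivative_add, derivative_sub, derivative_mul, derivative_pow, derivative_X,
    derivative_C, derivative_one, derivative_ofNat, derivative_zero, eval_add, eval_sub, eval_mul,
    eval_pow, eval_X, eval_C, eval_one, eval_zero, eval_ofNat]
  obtain ⟨y, rfl⟩ : ∃ y, x = 1 - y := ⟨1 - x, by ring⟩
  rw [sub_sub_cancel]
  rcases ν with _ | _ | _ | ν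
  · simp
    ring
  · simp
    ring
  · simp
    ring
  · simp only [Nat.add_one_sub_one]
    push_cast
    ring

/-! ### Recurrences in the degree -/

namespace IsJacobiFunctional

variable {a b : ℝ} {Λ : ℝ[X] →ₗ[ℝ] ℝ}

theorem map_X_pow_succ (hΛ : IsJacobiFunctional a b Λ) (k : ℕ) :
    (a + b + 2 + k) * Λ (X ^ (k + 1)) = (a + 1 + k) * Λ (X ^ k) := by
  have h := hΛ (X ^ k)
  have e : X * (1 - X) * derivative (X ^ k) + (C (a + 1) - C (a + b + 2) * X) * X ^ k
      = C (a + 1 + k) * X ^ k - C (a + b + 2 + k) * X ^ (k + 1) := by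
    rcases k with _ | k
    · simp
    · simp only [derivative_X_pow, Nat.add_one_sub_one, C_add, C_eq_natCast]
      ring
  rw [e, map_sub, map_C_mul, map_C_mul] at h
  linarith

theorem norm_succ (hΛ : IsJacobiFunctional a b Λ) (ha : -1 < a) (hab : 0 < a + b + 1) (m : ℕ) :
    (2 * m + a + b + 3) * (m + 1) * (m + (a + b + 1)) * Λ (jacobiPoly (m + 1) a b ^ 2)
      = (m + a + 1) * (m + b + 1) * (2 * m + (a + b + 1)) * Λ (jacobiPoly m a b ^ 2) := by
  have h1 := hΛ.map_raiseKernel ha m 1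
  have h2 := congrArg (fun f => Λ (jacobiPoly m a b ^ 2 * f)) (raiseKernel_one m a b)
  simp only [mul_add (jacobiPoly m _ _ ^ 2), hΛ.map_momentKernel, map_add Λ, add_zero] at h2
  rw [mul_one] at h1
  rw [mul_left_comm, map_C_mul, ← h1, mul_comm _ (C _), map_C_mul] at h2
  have hm : (m : ℝ) + 1 ≠ 0 := by positivity
  have hm' : (m : ℝ) + (a + b + 1) ≠ 0 := by positivity
  refine mul_left_cancel₀ (mul_ne_zero hm hm') ?_
  linear_combination h2 / 2

theorem norm_pos (hΛ : IsJacobiFunctional a b Λ) (ha : -1 < a) (hb : -1 < b)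
    (hab : 0 < a + b + 1) (h0 : 0 < Λ 1) (m : ℕ) : 0 < Λ (jacobiPoly m a b ^ 2) := by
  induction m with
  | zero => simpa [jacobiPoly] using h0
  | succ m ih =>
    have h := hΛ.norm_succ ha hab m
    have hm : (0 : ℝ) ≤ m := by positivity
    have h1 : 0 < (2 * m + a + b + 3) * (m + 1) * (m + (a + b + 1)) := by
      have : 0 < 2 * m + a + b + 3 := by linarith
      positivity
    have h2 : 0 < (m + a + 1) * (m + b + 1) * (2 * m + (a + b + 1)) := by
      have : 0 < m + a + 1 := by linarith
      have : 0 < m + b + 1 := by linarith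
      positivity
    have h3 := mul_pos h2 ih
    rw [← h] at h3
    exact pos_of_mul_pos_right h3 h1.le

theorem map_jacobiPoly_X_pow (m n : ℕ) {d : ℝ} (hd : d = n + 1)
    (hΛ : IsJacobiFunctional d 1 Λ) :
    (m + 1) * (m + d + 2) * (2 * d + 2 * m + 3) * Λ (jacobiPoly (m + 1) d 1 ^ 2 * X ^ (n + 1))
      = (m + d + 1) ^ 2 * (2 * m + 3) * Λ (jacobiPoly m d 1 ^ 2 * X ^ (n + 1)) := by
  have hd0 : 0 < d := by rw [hd]; positivity
  have h1 := hΛ.map_raiseKernel (by linarith) m (X ^ (n + 1))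
  have h2 := congrArg (fun f => Λ (jacobiPoly m d 1 ^ 2 * f)) (raiseKernel_X_pow m n d hd)
  simp only [mul_add (jacobiPoly m _ _ ^ 2), hΛ.map_momentKernel, map_add Λ, add_zero] at h2
  rw [mul_left_comm, map_C_mul, ← h1, mul_left_comm _ (C _), map_C_mul] at h2
  have hm : (m : ℝ) + 1 ≠ 0 := by positivity
  have hm' : (m : ℝ) + d + 2 ≠ 0 := by positivity
  refine mul_left_cancel₀ (mul_ne_zero hm (pow_ne_zero 2 hm')) ?_
  linear_combination h2 / 2

theorem map_jacobiPoly_weight (m n : ℕ) {d : ℝ} (hd : d = n + 1)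
    (hΛ : IsJacobiFunctional d 1 Λ) :
    (d + 1) * (2 * m + 1) * (2 * d + 2 * m + 3) * (2 * d + 2 * m + 5) * (m + 1) * (m + d + 2) ^ 2
        * Λ (jacobiPoly (m + 1) d 1 ^ 2 * (X ^ n * (1 - X) ^ 2))
      = (d + 1) * (2 * m + 1) * (2 * d + 2 * m + 3) * (2 * d + 2 * m + 5) * (m + 1) * (m + 2) ^ 2
          * Λ (jacobiPoly m d 1 ^ 2 * (X ^ n * (1 - X) ^ 2))
        + (m + 2) * (m + d + 1) * (2 * m + d + 3)
          * (3 * ((2 * m + 1) * d + 2 * m ^ 2 + 6 * m + 3))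
          * Λ (jacobiPoly m d 1 ^ 2 * X ^ (n + 1)) := by
  have hd0 : 0 < d := by rw [hd]; positivity
  have h1 := hΛ.map_raiseKernel (by linarith) m (X ^ n * (1 - X) ^ 2)
  have h2 := congrArg (fun f => Λ (jacobiPoly m d 1 ^ 2 * f)) (raiseKernel_weight m n d hd)
  simp only [mul_add (jacobiPoly m d 1 ^ 2), hΛ.map_momentKernel, map_add Λ, add_zero] at h2
  rw [mul_left_comm, map_C_mul, ← h1, mul_left_comm _ (C _), map_C_mul,
    mul_left_comm _ (C _), map_C_mul] at h2
  have hm : (m : ℝ) + 1 ≠ 0 := by positivity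
  have hm' : (m : ℝ) + d + 2 ≠ 0 := by positivity
  refine mul_left_cancel₀ (mul_ne_zero hm hm') ?_
  linear_combination h2 / 2

end IsJacobiFunctional

/-! ### The estimate for the wave maps model -/

/-- The estimate behind the wave maps model. Since `n` is nonincreasing from index `1` on, the
contribution of `n m` to `u (m + 1)` is controlled by `u 0`, and the bound
`2 u m (d + 2)² < u 0 (2m + d + 2)²` is inherited from `m` to `m + 1`. At `m = 0` it fails, so the
induction starts from the explicit value of `u 1`. -/
theorem two_mul_lt_of_recurrence {d : ℝ} (hd : 1 ≤ d) {u n : ℕ → ℝ}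
    (h0 : d * (2 * d + 3) * u 0 = 3 * n 0)
    (hn0 : 0 < n 0)
    (hn : ∀ m : ℕ, (2 * m + d + 2) * (m + 2) * (2 * m + 2 * d + 3) * n (m + 1)
      = (2 * m + d + 4) * (m + d + 1) * (2 * m + 3) * n m)
    (hu : ∀ m : ℕ, u (m + 1) = (2 * m + d + 4) / (2 * m + d + 2) *
      ((m + 1) * (m + 2) / ((m + d + 1) * (m + d + 2)) * u m
        + (2 * m + d + 3) * (3 * ((2 * m + 1) * d + 2 * m ^ 2 + 6 * m + 3))
          / ((2 * m + 2 * d + 3) * (2 * m + 2 * d + 5) * (m + d + 2) * (2 * m + 1) * (d + 1))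
          * n m)) (m : ℕ) :
    0 < u (m + 1) ∧ 2 * u (m + 1) * (d + 2) ^ 2 < u 0 * (2 * (m + 1) + d + 2) ^ 2 := by
  have hnpos : ∀ m, 0 < n m := by
    intro m
    induction m with
    | zero => exact hn0
    | succ m ih =>
      have h := hn m
      have : 0 < (2 * m + d + 4) * (m + d + 1) * (2 * m + 3) * n m := by positivity
      rw [← h] at this
      exact pos_of_mul_pos_right this (by positivity)
  have hU : 0 < u 0 := by
    have : 0 < d * (2 * d + 3) * u 0 := by rw [h0]; positivity
    exact pos_of_mul_pos_right this (by positivity)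
  have hn0' : n 0 = d * (2 * d + 3) * u 0 / 3 := by linarith
  have hn1 : n 1 = d * (d + 4) * (d + 1) * u 0 / (2 * (d + 2)) := by
    have h := hn 0
    simp only [CharP.cast_eq_zero, zero_add, mul_zero] at h
    rw [hn0'] at h
    field_simp
    have h2 : (2 * d + 3) ≠ 0 := by positivity
    refine mul_left_cancel₀ h2 ?_
    linear_combination h
  have hnle : ∀ m, n (m + 1) ≤ n 1 := by
    intro m
    induction m with
    | zero => exact le_rfl
    | succ m ih =>
      refine le_trans ?_ ih
      have h := hn (m + 1)
      push_cast at h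
      have h3 : (2 * ((m : ℝ) + 1) + d + 4) * (m + 1 + d + 1) * (2 * (m + 1) + 3)
          ≤ (2 * ((m : ℝ) + 1) + d + 2) * (m + 1 + 2) * (2 * (m + 1) + 2 * d + 3) := by
        have : (0 : ℝ) ≤ m := by positivity
        obtain ⟨e, rfl⟩ : ∃ e, d = 1 + e := ⟨d - 1, by ring⟩
        have : 0 ≤ e := by linarith
        rw [← sub_nonneg]
        ring_nf
        positivity
      have h4 : 0 < (2 * ((m : ℝ) + 1) + d + 2) * (m + 1 + 2) * (2 * (m + 1) + 2 * d + 3) := by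
        positivity
      refine le_of_mul_le_mul_left ?_ h4
      rw [h]
      exact mul_le_mul_of_nonneg_right h3 (hnpos _).le
  induction m with
  | zero =>
    have h := hu 0
    rw [hn0'] at h
    simp only [CharP.cast_eq_zero, zero_add, mul_zero] at h ⊢
    have h1 : u 1 = (d + 4) * (2 * (2 * d + 5) + d * (d + 3) ^ 2)
        / ((d + 2) ^ 2 * (d + 1) * (2 * d + 5)) * u 0 := by
      rw [h]; field_simp; ring
    refine ⟨by rw [h1]; positivity, ?_⟩
    have h2 : u 0 * (2 * 1 + d + 2) ^ 2 - 2 * u 1 * (d + 2) ^ 2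
        = (d + 4) * (3 * d ^ 2 + 7 * d) / ((d + 1) * (2 * d + 5)) * u 0 := by
      rw [h1]; field_simp; ring
    have h3 : 0 < (d + 4) * (3 * d ^ 2 + 7 * d) / ((d + 1) * (2 * d + 5)) * u 0 := by positivity
    linarith
  | succ m ih =>
    obtain ⟨ih0, ih⟩ := ih
    have h := hu (m + 1)
    have hpos := hnpos (m + 1)
    have hle := hnle m
    push_cast at h ⊢
    obtain ⟨x, hx⟩ : ∃ x : ℝ, x = m + 1 := ⟨_, rfl⟩
    have hx1 : 1 ≤ x := by rw [hx]; simp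
    rw [← hx] at h ih ⊢
    generalize n (m + 1) = N at *
    generalize u (m + 1) = V at *
    refine ⟨by rw [h]; positivity, ?_⟩
    have hL : 3 * ((2 * x + 1) * d + 2 * x ^ 2 + 6 * x + 3) * (x + d + 1)
        ≤ (2 * x + 2 * d + 3) * (2 * x + 2 * d + 5) * (2 * x + 1) := by
      obtain ⟨y, rfl⟩ : ∃ y, x = 1 + y := ⟨x - 1, by ring⟩
      have : 0 ≤ y := by linarith
      rw [← sub_nonneg]
      ring_nf
      positivity
    -- The quadratic factor from the recurrence is absorbed by the denominators.
    have hB : (2 * x + d + 3) * (3 * ((2 * x + 1) * d + 2 * x ^ 2 + 6 * x + 3))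
          / ((2 * x + 2 * d + 3) * (2 * x + 2 * d + 5) * (x + d + 2) * (2 * x + 1) * (d + 1)) * N
        ≤ (2 * x + d + 3) / ((x + d + 1) * (x + d + 2) * (d + 1)) * N := by
      refine mul_le_mul_of_nonneg_right ?_ hpos.le
      rw [div_le_div_iff₀ (by positivity) (by positivity)]
      have : 0 ≤ (2 * x + d + 3) * ((x + d + 2) * (d + 1)) := by positivity
      nlinarith [mul_le_mul_of_nonneg_left hL this]
    have hB2 : (2 * x + d + 3) / ((x + d + 1) * (x + d + 2) * (d + 1)) * N
        ≤ (2 * x + d + 3) / ((x + d + 1) * (x + d + 2) * (d + 1))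
          * (d * (d + 4) * (d + 1) * u 0 / (2 * (d + 2))) := by
      rw [← hn1]
      exact mul_le_mul_of_nonneg_left hle (by positivity)
    have hA : (x + 1) * (x + 2) / ((x + d + 1) * (x + d + 2)) * (2 * (d + 2) ^ 2 * V)
        ≤ (x + 1) * (x + 2) / ((x + d + 1) * (x + d + 2)) * (u 0 * (2 * x + d + 2) ^ 2) :=
      mul_le_mul_of_nonneg_left (by linarith) (by positivity)
    have hω : (d + 4) * (d + 2) ≤ (2 * x + d + 2) ^ 2 := by nlinarith
    calc 2 * u (m + 1 + 1) * (d + 2) ^ 2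
        = (2 * x + d + 4) / (2 * x + d + 2) *
          ((x + 1) * (x + 2) / ((x + d + 1) * (x + d + 2)) * (2 * (d + 2) ^ 2 * V)
          + 2 * (d + 2) ^ 2 * ((2 * x + d + 3) * (3 * ((2 * x + 1) * d + 2 * x ^ 2 + 6 * x + 3))
          / ((2 * x + 2 * d + 3) * (2 * x + 2 * d + 5) * (x + d + 2) * (2 * x + 1) * (d + 1))
          * N)) := by rw [h]; ring
      _ ≤ (2 * x + d + 4) / (2 * x + d + 2) *
          ((x + 1) * (x + 2) / ((x + d + 1) * (x + d + 2)) * (u 0 * (2 * x + d + 2) ^ 2)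
          + 2 * (d + 2) ^ 2 * ((2 * x + d + 3) / ((x + d + 1) * (x + d + 2) * (d + 1))
          * (d * (d + 4) * (d + 1) * u 0 / (2 * (d + 2))))) := by
        gcongr ?_ * (?_ + ?_ * ?_)
        exact hB.trans hB2
      _ = (2 * x + d + 4) / (2 * x + d + 2) * u 0 / ((x + d + 1) * (x + d + 2)) *
          ((x + 1) * (x + 2) * (2 * x + d + 2) ^ 2
            + d * (2 * x + d + 3) * ((d + 4) * (d + 2))) := by
        field_simp
      _ ≤ (2 * x + d + 4) / (2 * x + d + 2) * u 0 / ((x + d + 1) * (x + d + 2)) *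
          ((x + 1) * (x + 2) * (2 * x + d + 2) ^ 2
            + d * (2 * x + d + 3) * (2 * x + d + 2) ^ 2) := by gcongr
      -- `(x + d + 1) (x + d + 2) = (x + 1) (x + 2) + d (2 x + d + 3)`
      _ = u 0 * ((2 * x + d + 4) * (2 * x + d + 2)) := by field_simp; ring
      _ < u 0 * (2 * (x + 1) + d + 2) ^ 2 := by
        refine mul_lt_mul_of_pos_left ?_ hU
        nlinarith

/-! ### A Newton expansion of the moments for `a = 1/2` -/

/-- The number `(1/2)_j / j! = (2j choose j) / 4^j`. -/
def halfBinom (j : ℕ) : ℝ := ∏ i ∈ Finset.range j, ((i : ℝ) + 1 / 2) / (i + 1)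

/-- The product `∏_{i<k} (i + 1/2)(L - i(i+1)) / ((i+1)(z - (i+1)²))`. -/
def newtonTerm (L z : ℝ) (k : ℕ) : ℝ :=
  ∏ i ∈ Finset.range k, ((i : ℝ) + 1 / 2) * (L - i * (i + 1)) / ((i + 1) * (z - (i + 1) ^ 2))

/-- The convolution of `halfBinom` and `newtonTerm`, a Newton-type expansion in `z`. It gives the
moments of `1 - t` against `P_m²` for `a = 1/2`, with `z = ω_m²`. -/
def newtonSum (L z : ℝ) (ν : ℕ) : ℝ :=
  ∑ k ∈ Finset.range (ν + 1), halfBinom (ν - k) * newtonTerm L z k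

theorem halfBinom_succ (j : ℕ) : (j + 1) * halfBinom (j + 1) = (j + 1 / 2) * halfBinom j := by
  have : (j : ℝ) + 1 ≠ 0 := by positivity
  rw [halfBinom, Finset.prod_range_succ, ← halfBinom]
  field_simp

theorem newtonTerm_succ {L z : ℝ} {k : ℕ} (hz : z - (k + 1) ^ 2 ≠ 0) :
    (k + 1) * (z - (k + 1) ^ 2) * newtonTerm L z (k + 1)
      = (k + 1 / 2) * (L - k * (k + 1)) * newtonTerm L z k := by
  have : (k : ℝ) + 1 ≠ 0 := by positivity
  rw [newtonTerm, Finset.prod_range_succ, ← newtonTerm]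
  field_simp

theorem newtonSum_zero (L z : ℝ) : newtonSum L z 0 = 1 := by
  simp [newtonSum, halfBinom, newtonTerm]

theorem newtonSum_one {L z : ℝ} (hz : z - 1 ≠ 0) :
    (z - 1) * newtonSum L z 1 = 1 / 2 * (z + L - 1) := by
  simp [newtonSum, halfBinom, newtonTerm, Finset.sum_range_succ]
  field_simp
  ring

/-- `newtonSum` solves the three-term recurrence of the moments: the summand telescopes. -/
theorem newtonSum_recurrence {L z : ℝ} (μ : ℕ)
    (hz : ∀ i : ℕ, i ≤ μ + 1 → z - ((i : ℝ) + 1) ^ 2 ≠ 0) :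
    ((μ : ℝ) + 2) * (z - (μ + 2) ^ 2) * newtonSum L z (μ + 2)
      - (μ + 3 / 2) * (z + L - (μ + 2) ^ 2 - (μ + 1) ^ 2) * newtonSum L z (μ + 1)
      + (μ + 1) * (L + 1 / 4 - (μ + 1) ^ 2) * newtonSum L z μ = 0 := by
  have tele : ∀ n ≤ μ + 1, ∑ k ∈ Finset.range n,
      (((μ : ℝ) + 2) * (z - (μ + 2) ^ 2) * (halfBinom (μ + 2 - k) * newtonTerm L z k)
      - (μ + 3 / 2) * (z + L - (μ + 2) ^ 2 - (μ + 1) ^ 2)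
        * (halfBinom (μ + 1 - k) * newtonTerm L z k)
      + (μ + 1) * (L + 1 / 4 - (μ + 1) ^ 2) * (halfBinom (μ - k) * newtonTerm L z k))
      = n * (z - n ^ 2) * halfBinom (μ + 1 - n) / (2 * (μ + 2 - n)) * newtonTerm L z n := by
    intro n hn
    induction n with
    | zero => simp
    | succ n ih =>
      obtain ⟨j, rfl⟩ : ∃ j, μ = n + j := ⟨μ - n, by omega⟩
      rw [Finset.sum_range_succ, ih (by omega), show n + j + 2 - n = j + 2 by omega,
        show n + j + 1 - n = j + 1 by omega, show n + j - n = j by omega,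
        show n + j + 1 - (n + 1) = j by omega]
      have h1 := halfBinom_succ j
      have h2 := halfBinom_succ (j + 1)
      have h3 := newtonTerm_succ (L := L) (hz n (by omega))
      have hj : (j : ℝ) + 1 ≠ 0 := by positivity
      have hj2 : (j : ℝ) + 2 ≠ 0 := by positivity
      push_cast at h2 h3 ⊢
      rw [show (j : ℝ) + 1 + 1 = j + 2 by ring] at h2
      have h1' : halfBinom (j + 1) = (j + 1 / 2) * halfBinom j / (j + 1) := by
        rw [eq_div_iff hj]; linear_combination h1
      have h2' : halfBinom (j + 2)
          = (j + 3 / 2) * ((j + 1 / 2) * halfBinom j / (j + 1)) / (j + 2) := by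
        rw [← h1', eq_div_iff hj2]; linear_combination h2
      have e : ((n : ℝ) + 1) * (z - (n + 1) ^ 2) * halfBinom j / (2 * (n + j + 2 - (n + 1)))
          * newtonTerm L z (n + 1)
          = halfBinom j / (2 * (j + 1)) *
            ((n + 1 / 2) * (L - n * (n + 1)) * newtonTerm L z n) := by
        rw [← h3, show (n : ℝ) + j + 2 - (n + 1) = j + 1 by ring]; ring
      rw [e, h1', h2', show (n : ℝ) + j + 2 - n = j + 2 by ring]
      field_simp
      ring
  have t := tele (μ + 1) le_rfl
  have h3 := newtonTerm_succ (L := L) (hz (μ + 1) le_rfl)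
  rw [Finset.sum_add_distrib, Finset.sum_sub_distrib, ← Finset.mul_sum, ← Finset.mul_sum,
    ← Finset.mul_sum] at t
  simp only [newtonSum]
  rw [Finset.sum_range_succ _ (μ + 2), Finset.sum_range_succ _ (μ + 1),
    Finset.sum_range_succ (fun k => halfBinom (μ + 1 - k) * newtonTerm L z k) (μ + 1)]
  simp only [Nat.sub_self, show μ + 2 - (μ + 1) = 1 by omega] at t ⊢
  push_cast at t h3
  rw [show halfBinom 0 = 1 by simp [halfBinom]] at t ⊢
  rw [show halfBinom 1 = 1 / 2 by simp [halfBinom]]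
  rw [show (μ : ℝ) + 2 - (μ + 1) = 1 by ring] at t
  linear_combination t + h3

/-- For `L = ν(ν-1)` all factors of all terms of `newtonSum` are nonnegative, and each is nonincreasing
in `z`. -/
theorem newtonSum_anti {ν : ℕ} {z z' : ℝ} (hz : ((ν : ℝ) + 1) ^ 2 ≤ z) (hzz' : z ≤ z') :
    newtonSum (ν * (ν - 1)) z' ν ≤ newtonSum (ν * (ν - 1)) z ν := by
  refine Finset.sum_le_sum fun k hk => ?_
  have hk' : k ≤ ν := by simpa [Nat.lt_succ_iff] using hk
  refine mul_le_mul_of_nonneg_left ?_ (Finset.prod_nonneg fun i _ => by positivity)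
  have hi : ∀ i ∈ Finset.range k, (i : ℝ) + 1 ≤ ν := fun i hi => by
    have : i + 1 ≤ ν := by have := Finset.mem_range.1 hi; omega
    exact_mod_cast this
  have hL : ∀ i ∈ Finset.range k, 0 ≤ (ν : ℝ) * (ν - 1) - i * (i + 1) := fun i h => by
    have h1 := hi i h
    have h2 : (0 : ℝ) ≤ i := by positivity
    nlinarith
  have hpos : ∀ i ∈ Finset.range k, 0 < z - ((i : ℝ) + 1) ^ 2 := fun i h => by
    have h1 := hi i h
    have h2 : (0 : ℝ) ≤ i := by positivity
    nlinarith
  refine Finset.prod_le_prod (fun i h => ?_) fun i h => ?_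
  · have h1 := hL i h
    have h2 := hpos i h
    have h3 : 0 < z' - ((i : ℝ) + 1) ^ 2 := by linarith
    positivity
  · have h1 := hL i h
    have h2 := hpos i h
    gcongr

namespace IsJacobiFunctional

variable {a b : ℝ} {Λ : ℝ[X] →ₗ[ℝ] ℝ}

/-- The case `a = 1/2`, in which the moments of `1 - t` are given by `newtonSum`. The hypothesis keeps
`ω² = (2m + b + 3/2)²` away from the poles `1, 4, …, ν²`. -/
theorem map_one_sub_X_pow_mul (hΛ : IsJacobiFunctional (1 / 2) b Λ) (m ν : ℕ)
    (hν : (ν : ℝ) < 2 * m + b + 3 / 2) :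
    Λ (jacobiPoly m (1 / 2) b ^ 2 * (1 - X) ^ ν)
      = newtonSum (b ^ 2 - 1 / 4) ((2 * m + b + 3 / 2) ^ 2) ν * Λ (jacobiPoly m (1 / 2) b ^ 2) := by
  have hrec : ∀ μ : ℕ, ((μ : ℝ) + 1) * ((2 * m + b + 3 / 2) ^ 2 - (μ + 1) ^ 2)
        * Λ (jacobiPoly m (1 / 2) b ^ 2 * (1 - X) ^ (μ + 1))
      - (μ + 1 / 2) * ((2 * m + b + 3 / 2) ^ 2 + (b ^ 2 - 1 / 4) - (μ + 1) ^ 2 - μ ^ 2)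
        * Λ (jacobiPoly m (1 / 2) b ^ 2 * (1 - X) ^ μ)
      + μ * (b ^ 2 - μ ^ 2) * Λ (jacobiPoly m (1 / 2) b ^ 2 * (1 - X) ^ (μ - 1)) = 0 := by
    intro μ
    have h := hΛ.map_momentKernel m ((1 - X) ^ μ)
    rw [momentKernel_one_sub_X_pow, mul_add, mul_sub, mul_left_comm, mul_left_comm _ (C _),
      mul_left_comm _ (C _), map_add, map_sub, map_C_mul, map_C_mul, map_C_mul] at h
    linear_combination h
  have hz : ∀ i : ℕ, (i : ℝ) + 1 < 2 * m + b + 3 / 2 →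
      (2 * m + b + 3 / 2) ^ 2 - ((i : ℝ) + 1) ^ 2 ≠ 0 := fun i hi => by
    have : (0 : ℝ) ≤ i := by positivity
    nlinarith
  induction ν using Nat.strong_induction_on with
  | _ ν ih =>
    rcases ν with _ | _ | μ
    · simp [newtonSum_zero]
    · have h := hrec 0
      have hz0 := hz 0 (by simpa using hν)
      simp only [CharP.cast_eq_zero, zero_add, one_pow] at hz0
      have hS := newtonSum_one (L := b ^ 2 - 1 / 4) hz0
      simp only [CharP.cast_eq_zero, zero_add, pow_zero, mul_one] at h ⊢
      refine mul_left_cancel₀ hz0 ?_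
      linear_combination h - Λ (jacobiPoly m (1 / 2) b ^ 2) * hS
    · push_cast at hν
      have h := hrec (μ + 1)
      have hz0 := hz (μ + 1) (by push_cast; linarith)
      have hS := newtonSum_recurrence (L := b ^ 2 - 1 / 4) (z := (2 * m + b + 3 / 2) ^ 2) μ
        fun i hi => hz i (by
          have : (i : ℝ) ≤ μ + 1 := by exact_mod_cast hi
          linarith)
      rw [ih (μ + 1) (by omega) (by push_cast; linarith), Nat.add_sub_cancel,
        ih μ (by omega) (by linarith)] at h
      have hμ : ((μ : ℝ) + 2) ≠ 0 := by positivity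
      push_cast at h hz0
      refine mul_left_cancel₀ (mul_ne_zero hμ hz0) ?_
      linear_combination h - Λ (jacobiPoly m (1 / 2) b ^ 2) * hS

/-- The functional `f ↦ Λ (f (1-t)^μ)`. -/
def mulOneSubXPow (Λ : ℝ[X] →ₗ[ℝ] ℝ) (μ : ℕ) : ℝ[X] →ₗ[ℝ] ℝ :=
  Λ ∘ₗ LinearMap.mulRight ℝ ((1 - X) ^ μ)

theorem mulOneSubXPow_apply (Λ : ℝ[X] →ₗ[ℝ] ℝ) (μ : ℕ) (f : ℝ[X]) :
    mulOneSubXPow Λ μ f = Λ (f * (1 - X) ^ μ) := rfl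

/-- Multiplication by `(1-t)^μ` shifts the parameter `b` by `μ`. -/
theorem isJacobiFunctional_mulOneSubXPow (hΛ : IsJacobiFunctional a b Λ) (μ : ℕ) :
    IsJacobiFunctional a (b + μ) (mulOneSubXPow Λ μ) := by
  intro f
  rw [mulOneSubXPow_apply, ← hΛ (f * (1 - X) ^ μ)]
  congr 1
  rcases μ with _ | μ
  · simp
  · simp only [derivative_mul, derivative_pow, derivative_sub, derivative_one, derivative_X,
      Nat.add_one_sub_one, C_add, C_eq_natCast]
    ring

end IsJacobiFunctional

/-! ### The first two averages in the Klein--Gordon model -/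

theorem jacobiPoly_one (a b : ℝ) : jacobiPoly 1 a b = C (a + 1) - C (a + b + 2) * X := by
  refine Polynomial.funext fun x => ?_
  simp [jacobiPoly, Finset.sum_range_succ]
  ring

theorem jacobiPoly_two (a b : ℝ) : jacobiPoly 2 a b = C ((a + 1) * (a + 2) / 2)
    - C ((a + b + 3) * (a + 2)) * X + C ((a + b + 3) * (a + b + 4) / 2) * X ^ 2 := by
  refine Polynomial.funext fun x => ?_
  simp [jacobiPoly, Finset.sum_range_succ, ascPochhammer_succ_eval]
  ring

namespace IsJacobiFunctional

variable {b : ℝ} {Λ : ℝ[X] →ₗ[ℝ] ℝ}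

theorem map_jacobiPoly_one_sq (Λ : ℝ[X] →ₗ[ℝ] ℝ) (a' b' : ℝ) :
    Λ (jacobiPoly 1 a' b' ^ 2) = (a' + 1) ^ 2 * Λ (X ^ 0)
      - 2 * (a' + 1) * (a' + b' + 2) * Λ (X ^ 1) + (a' + b' + 2) ^ 2 * Λ (X ^ 2) := by
  rw [jacobiPoly_one]
  simp only [← map_C_mul, ← map_sub, ← map_add]
  congr 1
  simp only [C_mul, C_pow, map_ofNat]
  ring

theorem map_jacobiPoly_two_sq (Λ : ℝ[X] →ₗ[ℝ] ℝ) (a' b' : ℝ) :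
    Λ (jacobiPoly 2 a' b' ^ 2) = ((a' + 1) * (a' + 2) / 2) ^ 2 * Λ (X ^ 0)
      - (a' + 1) * (a' + 2) * ((a' + b' + 3) * (a' + 2)) * Λ (X ^ 1)
      + (((a' + b' + 3) * (a' + 2)) ^ 2
        + (a' + 1) * (a' + 2) * ((a' + b' + 3) * (a' + b' + 4) / 2)) * Λ (X ^ 2)
      - (a' + b' + 3) * (a' + 2) * ((a' + b' + 3) * (a' + b' + 4)) * Λ (X ^ 3)
      + ((a' + b' + 3) * (a' + b' + 4) / 2) ^ 2 * Λ (X ^ 4) := by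
  rw [jacobiPoly_two]
  simp only [← map_C_mul, ← map_sub, ← map_add]
  congr 1
  refine Polynomial.funext fun x => ?_
  simp only [eval_add, eval_sub, eval_mul, eval_pow, eval_X, eval_C]
  ring

variable {δ : ℕ}

/-- Multiplication by `(1-t)^(δ-1)` yields another Jacobi functional, so the numerator reduces to the
moments of `t` up to order two, which are known relative to the total mass. -/
theorem kg_ratio_one (hδ : 2 ≤ δ) (hΛ : IsJacobiFunctional (1 / 2) (δ - 3 / 2) Λ)
    (h0 : 0 < Λ 1) :
    Λ (jacobiPoly 1 (1 / 2) (δ - 3 / 2) ^ 2 * (1 - X) ^ (δ - 1))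
        / Λ (jacobiPoly 1 (1 / 2) (δ - 3 / 2) ^ 2)
      = (5 * δ ^ 2 - 2 * δ - 1) * (δ + 2) / (2 * δ * (4 * δ ^ 2 - 1))
        * (Λ ((1 - X) ^ (δ - 1)) / Λ 1) := by
  have hd : (2 : ℝ) ≤ δ := by exact_mod_cast hδ
  have hΛ' := isJacobiFunctional_mulOneSubXPow hΛ (δ - 1)
  have e : ((δ - 1 : ℕ) : ℝ) = δ - 1 := by push_cast [show 1 ≤ δ by omega]; ring
  rw [e] at hΛ'
  rw [← mulOneSubXPow_apply, ← one_mul ((1 - X) ^ (δ - 1) : ℝ[X]), ← mulOneSubXPow_apply]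
  generalize mulOneSubXPow Λ (δ - 1) = Λ' at *
  have n1 := hΛ.norm_succ (by norm_num) (by linarith) 0
  have n0 : Λ (jacobiPoly 0 (1 / 2) (δ - 3 / 2) ^ 2) = Λ 1 := by simp [jacobiPoly]
  have t0 := hΛ'.map_X_pow_succ 0
  have t1 := hΛ'.map_X_pow_succ 1
  rw [n0] at n1
  simp only [CharP.cast_eq_zero, zero_add, mul_zero, pow_zero, Nat.cast_one, Nat.reduceAdd,
    add_zero] at n1 t0 t1
  rw [map_jacobiPoly_one_sq Λ', pow_zero]
  generalize Λ (jacobiPoly 1 (1 / 2) (δ - 3 / 2) ^ 2) = H at *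
  generalize (δ : ℝ) = d at *
  generalize Λ' (X ^ 1) = T₁ at *
  generalize Λ' (X ^ 2) = T₂ at *
  generalize Λ' 1 = T₀ at *
  generalize Λ 1 = A at *
  have hd1 : 0 < 2 * d - 1 := by linarith
  have e1 : H = 3 * (2 * d - 1) / (4 * (d + 2)) * A := by
    rw [div_mul_eq_mul_div, eq_div_iff (by positivity)]
    refine mul_left_cancel₀ (show d ≠ 0 by positivity) ?_
    linear_combination 4 * n1
  have e2 : T₁ = 3 / (4 * d) * T₀ := by
    rw [div_mul_eq_mul_div, eq_div_iff (by positivity)]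
    linear_combination 2 * t0
  have e3 : T₂ = 5 / (2 * (2 * d + 1)) * T₁ := by
    rw [div_mul_eq_mul_div, eq_div_iff (by positivity)]
    linear_combination 2 * t1
  rw [e3, e2, e1, show 4 * d ^ 2 - 1 = (2 * d - 1) * (2 * d + 1) by ring]
  field_simp
  ring

/-- The same computation as in `kg_ratio_one`, with moments up to order four. With `δ = x + 2` the
difference of the two sides is, up to a positive factor, a quotient of polynomials in `x` with
positive coefficients. -/
theorem kg_ratio_two (hδ : 2 ≤ δ) (hΛ : IsJacobiFunctional (1 / 2) (δ - 3 / 2) Λ)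
    (h0 : 0 < Λ 1) (hW : 0 < Λ ((1 - X) ^ (δ - 1))) :
    2 * (Λ (jacobiPoly 2 (1 / 2) (δ - 3 / 2) ^ 2 * (1 - X) ^ (δ - 1))
        / Λ (jacobiPoly 2 (1 / 2) (δ - 3 / 2) ^ 2)) * δ ^ 2
      < Λ ((1 - X) ^ (δ - 1)) / Λ 1 * (4 + δ) ^ 2 := by
  have hd : (2 : ℝ) ≤ δ := by exact_mod_cast hδ
  have hΛ' := isJacobiFunctional_mulOneSubXPow hΛ (δ - 1)
  have e : ((δ - 1 : ℕ) : ℝ) = δ - 1 := by push_cast [show 1 ≤ δ by omega]; ring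
  rw [e] at hΛ'
  rw [← one_mul ((1 - X) ^ (δ - 1) : ℝ[X]), ← mulOneSubXPow_apply] at hW
  rw [← mulOneSubXPow_apply, ← one_mul ((1 - X) ^ (δ - 1) : ℝ[X]), ← mulOneSubXPow_apply]
  generalize mulOneSubXPow Λ (δ - 1) = Λ' at *
  have n1 := hΛ.norm_succ (by norm_num) (by linarith) 0
  have n2 := hΛ.norm_succ (by norm_num) (by linarith) 1
  have n0 : Λ (jacobiPoly 0 (1 / 2) (δ - 3 / 2) ^ 2) = Λ 1 := by simp [jacobiPoly]
  have t0 := hΛ'.map_X_pow_succ 0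
  have t1 := hΛ'.map_X_pow_succ 1
  have t2 := hΛ'.map_X_pow_succ 2
  have t3 := hΛ'.map_X_pow_succ 3
  rw [n0] at n1
  simp only [CharP.cast_eq_zero, zero_add, mul_zero, pow_zero, Nat.cast_one, Nat.reduceAdd,
    add_zero, Nat.cast_ofNat] at n1 n2 t0 t1 t2 t3
  rw [map_jacobiPoly_two_sq Λ', pow_zero]
  generalize Λ (jacobiPoly 1 (1 / 2) (δ - 3 / 2) ^ 2) = H₁ at *
  generalize Λ (jacobiPoly 2 (1 / 2) (δ - 3 / 2) ^ 2) = H₂ at *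
  generalize (δ : ℝ) = d at *
  generalize Λ' (X ^ 1) = T₁ at *
  generalize Λ' (X ^ 2) = T₂ at *
  generalize Λ' (X ^ 3) = T₃ at *
  generalize Λ' (X ^ 4) = T₄ at *
  generalize Λ' 1 = T₀ at *
  generalize Λ 1 = A at *
  have hd1 : 0 < 2 * d - 1 := by linarith
  have e1 : H₁ = 3 * (2 * d - 1) / (4 * (d + 2)) * A := by
    rw [div_mul_eq_mul_div, eq_div_iff (by positivity)]
    refine mul_left_cancel₀ (show d ≠ 0 by positivity) ?_
    linear_combination 4 * n1
  have e1' : H₂ = 5 * (2 * d + 1) * (d + 2) / (8 * (d + 4) * (d + 1)) * H₁ := by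
    rw [div_mul_eq_mul_div, eq_div_iff (by positivity)]
    linear_combination 4 * n2
  have e2 : T₁ = 3 / (4 * d) * T₀ := by
    rw [div_mul_eq_mul_div, eq_div_iff (by positivity)]
    linear_combination 2 * t0
  have e3 : T₂ = 5 / (2 * (2 * d + 1)) * T₁ := by
    rw [div_mul_eq_mul_div, eq_div_iff (by positivity)]
    linear_combination 2 * t1
  have e4 : T₃ = 7 / (4 * (d + 1)) * T₂ := by
    rw [div_mul_eq_mul_div, eq_div_iff (by positivity)]
    linear_combination 2 * t2
  have e5 : T₄ = 9 / (2 * (2 * d + 3)) * T₃ := by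
    rw [div_mul_eq_mul_div, eq_div_iff (by positivity)]
    linear_combination 2 * t3
  rw [e5, e4, e3, e2, e1', e1]
  obtain ⟨x, rfl⟩ : ∃ x : ℝ, d = x + 2 := ⟨d - 2, by ring⟩
  have hx : 0 ≤ x := by linarith
  rw [show 2 * (x + 2) - 1 = 2 * x + 3 by ring, ← sub_pos]
  field_simp
  ring_nf
  positivity

end IsJacobiFunctional

/-! ### Trigonometric integrals as Jacobi functionals -/

/-- The functional `f ↦ ∫_0^{π/2} f(sin² x) sin^p x cos^q x dx`. -/
def trigFunctional (p q : ℕ) : ℝ[X] →ₗ[ℝ] ℝ where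
  toFun f := ∫ x in (0 : ℝ)..(Real.pi / 2),
    f.eval (Real.sin x ^ 2) * (Real.sin x ^ p * Real.cos x ^ q)
  map_add' f g := by
    simp only [eval_add, add_mul]
    exact intervalIntegral.integral_add
      (Continuous.intervalIntegrable (by fun_prop) _ _)
      (Continuous.intervalIntegrable (by fun_prop) _ _)
  map_smul' c f := by
    simp only [eval_smul, smul_eq_mul, mul_assoc, intervalIntegral.integral_const_mul,
      RingHom.id_apply]

theorem trigFunctional_apply (p q : ℕ) (f : ℝ[X]) :
    trigFunctional p q f = ∫ x in (0 : ℝ)..(Real.pi / 2),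
      f.eval (Real.sin x ^ 2) * (Real.sin x ^ p * Real.cos x ^ q) := rfl

theorem isJacobiFunctional_trigFunctional {a b : ℝ} {p q : ℕ} (hp : (p : ℝ) = 2 * a + 1)
    (hq : (q : ℝ) = 2 * b + 1) : IsJacobiFunctional a b (trigFunctional p q) := by
  intro f
  have key : ∀ x ∈ Set.uIcc (0 : ℝ) (Real.pi / 2), HasDerivAt
      (fun x => 1 / 2 * (f.eval (Real.sin x ^ 2) * (Real.sin x ^ (p + 1) * Real.cos x ^ (q + 1))))
      ((X * (1 - X) * derivative f + (C (a + 1) - C (a + b + 2) * X) * f).eval (Real.sin x ^ 2)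
        * (Real.sin x ^ p * Real.cos x ^ q)) x := by
    intro x _
    have h1 : HasDerivAt (fun x => f.eval (Real.sin x ^ 2))
        ((derivative f).eval (Real.sin x ^ 2) * (2 * Real.sin x * Real.cos x)) x := by
      refine ((f.hasDerivAt (Real.sin x ^ 2)).comp x ((Real.hasDerivAt_sin x).pow 2)).congr_deriv ?_
      simp
    have h2 := (Real.hasDerivAt_sin x).pow (p + 1)
    have h3 := (Real.hasDerivAt_cos x).pow (q + 1)
    refine ((h1.mul (h2.mul h3)).const_mul (1 / 2)).congr_deriv ?_
    simp only [eval_add, eval_mul, eval_sub, eval_X, eval_one, eval_C, Pi.mul_apply, Pi.pow_apply,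
      Nat.add_sub_cancel]
    push_cast
    rw [hp, hq]
    have hc : Real.cos x ^ 2 = 1 - Real.sin x ^ 2 := Real.cos_sq' x
    generalize Real.sin x = s at *
    generalize Real.cos x = c at *
    generalize eval (s ^ 2) f = F
    generalize eval (s ^ 2) (derivative f) = G
    linear_combination (s ^ 2 * G + (a + 1) * F) * (s ^ p * c ^ q) * hc
  rw [trigFunctional_apply, intervalIntegral.integral_eq_sub_of_hasDerivAt key
    (Continuous.intervalIntegrable (by fun_prop) _ _)]
  simp

theorem trigFunctional_nonneg {p q : ℕ} {f : ℝ[X]} (hf : ∀ t ∈ Set.Icc (0 : ℝ) 1, 0 ≤ f.eval t) :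
    0 ≤ trigFunctional p q f := by
  have hpi : (0 : ℝ) ≤ Real.pi / 2 := by positivity
  refine intervalIntegral.integral_nonneg hpi fun x hx => ?_
  have hs : 0 ≤ Real.sin x := Real.sin_nonneg_of_nonneg_of_le_pi hx.1 (by linarith [hx.2])
  have hc : 0 ≤ Real.cos x := Real.cos_nonneg_of_mem_Icc ⟨by linarith [hx.1], hx.2⟩
  have := hf (Real.sin x ^ 2) ⟨by positivity, Real.sin_sq_le_one x⟩
  positivity

theorem trigFunctional_pos {p q : ℕ} {f : ℝ[X]} (hf : ∀ t ∈ Set.Ioo (0 : ℝ) 1, 0 < f.eval t) :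
    0 < trigFunctional p q f := by
  have hpi : (0 : ℝ) < Real.pi / 2 := by positivity
  refine intervalIntegral.intervalIntegral_pos_of_pos_on
    (Continuous.intervalIntegrable (by fun_prop) _ _) (fun x hx => ?_) hpi
  have hs : 0 < Real.sin x := Real.sin_pos_of_pos_of_lt_pi hx.1 (by linarith [hx.2])
  have hc : 0 < Real.cos x := Real.cos_pos_of_mem_Ioo ⟨by linarith [hx.1], hx.2⟩
  have := hf (Real.sin x ^ 2) ⟨by positivity, by nlinarith [Real.sin_sq_add_cos_sq x]⟩
  positivity

/-! ### The two models -/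

/-- The first Jacobi parameter of the eigenfunctions. -/
def Model.jacobiA : Model → ℕ → ℝ
  | .KG, _ => 1 / 2
  | .WM, δ => δ

/-- The second Jacobi parameter of the eigenfunctions. -/
def Model.jacobiB : Model → ℕ → ℝ
  | .KG, δ => δ - 3 / 2
  | .WM, _ => 1

/-- Integration against `dμ`, as a functional on polynomials in `sin² x`. -/
def Model.functional : Model → ℕ → ℝ[X] →ₗ[ℝ] ℝ
  | .KG, δ => trigFunctional 2 (2 * δ - 2)
  | .WM, δ => trigFunctional (2 * δ + 1) 3

/-- The weight `W` as a polynomial in `sin² x`. -/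
def Model.weightPoly : Model → ℕ → ℝ[X]
  | .KG, δ => (1 - X) ^ (δ - 1)
  | .WM, δ => X ^ (δ - 1) * (1 - X) ^ 2

/-- The `m`-th eigenfunction, without its normalization, as a polynomial in `sin² x`. -/
def Model.jacobi (M : Model) (δ m : ℕ) : ℝ[X] := jacobiPoly m (M.jacobiA δ) (M.jacobiB δ)

/-- The average of `W` in the probability measure proportional to `e_m² dμ`. -/
def Model.average (M : Model) (δ m : ℕ) : ℝ :=
  M.functional δ (M.jacobi δ m ^ 2 * M.weightPoly δ) / M.functional δ (M.jacobi δ m ^ 2)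

theorem Model.isJacobiFunctional (M : Model) {δ : ℕ} (h : M.Admissible δ) :
    IsJacobiFunctional (M.jacobiA δ) (M.jacobiB δ) (M.functional δ) := by
  cases M with
  | KG =>
    refine isJacobiFunctional_trigFunctional (by norm_num [jacobiA]) ?_
    have h2 : 2 ≤ δ := h
    rw [Nat.cast_sub (by omega)]
    simp only [jacobiB]
    push_cast
    ring
  | WM => exact isJacobiFunctional_trigFunctional (by simp [jacobiA]) (by norm_num [jacobiB])

theorem Model.functional_pos (M : Model) (δ : ℕ) {f : ℝ[X]}
    (hf : ∀ t ∈ Set.Ioo (0 : ℝ) 1, 0 < f.eval t) : 0 < M.functional δ f := by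
  cases M <;> exact trigFunctional_pos hf

theorem Model.functional_nonneg (M : Model) (δ : ℕ) {f : ℝ[X]}
    (hf : ∀ t ∈ Set.Icc (0 : ℝ) 1, 0 ≤ f.eval t) : 0 ≤ M.functional δ f := by
  cases M <;> exact trigFunctional_nonneg hf

theorem Model.functional_one_pos (M : Model) (δ : ℕ) : 0 < M.functional δ 1 :=
  M.functional_pos δ fun t _ => by simp

theorem Model.jacobi_zero (M : Model) (δ : ℕ) : M.jacobi δ 0 = 1 := by
  simp [jacobi, jacobiPoly]

theorem Model.functional_jacobi_sq_pos (M : Model) {δ : ℕ} (h : M.Admissible δ) (m : ℕ) :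
    0 < M.functional δ (M.jacobi δ m ^ 2) := by
  refine (M.isJacobiFunctional h).norm_pos ?_ ?_ ?_ (M.functional_one_pos δ) m <;> cases M
  · norm_num [jacobiA]
  · simp only [jacobiA]; linarith [show (0 : ℝ) ≤ δ by positivity]
  · have : (2 : ℝ) ≤ δ := by exact_mod_cast (h : 2 ≤ δ)
    simp only [jacobiB]; linarith
  · norm_num [jacobiB]
  · have : (2 : ℝ) ≤ δ := by exact_mod_cast (h : 2 ≤ δ)
    simp only [jacobiA, jacobiB]; linarith
  · simp only [jacobiA, jacobiB]; linarith [show (0 : ℝ) ≤ δ by positivity]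

theorem Model.eval_weightPoly_mem (M : Model) (δ : ℕ) {t : ℝ} (ht : t ∈ Set.Icc (0 : ℝ) 1) :
    (M.weightPoly δ).eval t ∈ Set.Icc (0 : ℝ) 1 := by
  have h0 : 0 ≤ 1 - t := by linarith [ht.2]
  have h1 : 1 - t ≤ 1 := by linarith [ht.1]
  have h2 := ht.1
  cases M
  · simp only [weightPoly, eval_pow, eval_sub, eval_one, eval_X]
    exact ⟨by positivity, pow_le_one₀ h0 h1⟩
  · simp only [weightPoly, eval_mul, eval_pow, eval_sub, eval_one, eval_X]
    exact ⟨by positivity, mul_le_one₀ (pow_le_one₀ h2 ht.2) (by positivity) (pow_le_one₀ h0 h1)⟩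

theorem Model.functional_weightPoly_pos (M : Model) (δ : ℕ) :
    0 < M.functional δ (M.weightPoly δ) := by
  refine M.functional_pos δ fun t ht => ?_
  have h0 : 0 < 1 - t := by linarith [ht.2]
  have h1 := ht.1
  cases M
  · simp only [weightPoly, eval_pow, eval_sub, eval_one, eval_X]
    positivity
  · simp only [weightPoly, eval_mul, eval_pow, eval_sub, eval_one, eval_X]
    positivity

theorem Model.average_zero (M : Model) (δ : ℕ) :
    M.average δ 0 = M.functional δ (M.weightPoly δ) / M.functional δ 1 := by
  rw [average, jacobi_zero, one_pow, one_mul]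

theorem Model.average_zero_pos (M : Model) (δ : ℕ) : 0 < M.average δ 0 := by
  rw [average_zero]
  exact div_pos (M.functional_weightPoly_pos δ) (M.functional_one_pos δ)

theorem Model.average_nonneg (M : Model) (δ m : ℕ) : 0 ≤ M.average δ m := by
  refine div_nonneg (M.functional_nonneg δ fun t ht => ?_) (M.functional_nonneg δ fun t ht => ?_)
  · rw [eval_mul, eval_pow]
    exact mul_nonneg (sq_nonneg _) (M.eval_weightPoly_mem δ ht).1
  · rw [eval_pow]
    exact sq_nonneg _

theorem Model.average_le_one (M : Model) {δ : ℕ} (h : M.Admissible δ) (m : ℕ) :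
    M.average δ m ≤ 1 := by
  rw [average, div_le_one (M.functional_jacobi_sq_pos h m), ← sub_nonneg, ← map_sub]
  refine M.functional_nonneg δ fun t ht => ?_
  rw [eval_sub, eval_mul, eval_pow]
  nlinarith [sq_nonneg ((M.jacobi δ m).eval t), (M.eval_weightPoly_mem δ ht).2]

theorem Model.eigenfun_eq (M : Model) (δ m : ℕ) (x : ℝ) :
    M.eigenfun δ m x = M.normConst δ m * (M.jacobi δ m).eval (Real.sin x ^ 2) := by
  have h : Real.sin x ^ 2 = (1 - Real.cos (2 * x)) / 2 := by
    rw [Real.cos_two_mul, Real.cos_sq']; ring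
  cases M <;> rw [h, jacobi, eval_jacobiPoly] <;> rfl

theorem Model.nonlinWeight_eq (M : Model) {δ : ℕ} (h : M.Admissible δ) (x : ℝ) :
    M.nonlinWeight δ x = (M.weightPoly δ).eval (Real.sin x ^ 2) := by
  cases M
  · simp only [nonlinWeight, weightPoly, eval_pow, eval_sub, eval_one, eval_X, ← Real.cos_sq',
      ← pow_mul]
    congr 1
    omega
  · simp only [nonlinWeight, weightPoly, eval_mul, eval_pow, eval_sub, eval_one, eval_X,
      ← Real.cos_sq', ← pow_mul]
    congr 2
    omega

theorem Model.functional_eq_integral (M : Model) (δ : ℕ) (f : ℝ[X]) :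
    M.functional δ f = ∫ x in (0 : ℝ)..(Real.pi / 2),
      f.eval (Real.sin x ^ 2) * M.weight δ x := by
  cases M <;> rfl

theorem Model.fourierCoeff_eq (M : Model) {δ : ℕ} (h : M.Admissible δ) (m : ℕ) :
    M.fourierCoeff δ 0 0 m m = M.normConst δ 0 ^ 2 *
      (M.normConst δ m ^ 2 * M.functional δ (M.jacobi δ m ^ 2 * M.weightPoly δ)) := by
  rw [functional_eq_integral, ← mul_assoc, ← intervalIntegral.integral_const_mul, fourierCoeff,
    inner]
  refine intervalIntegral.integral_congr fun x _ => ?_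
  simp only [eigenfun_eq, M.nonlinWeight_eq h, jacobi_zero, eval_one, eval_mul, eval_pow]
  ring

theorem Model.normConst_sq_KG {δ : ℕ} (h : 2 ≤ δ) (m : ℕ) :
    Model.normConst .KG δ m ^ 2 = 2 * Real.Gamma (m + 1) / Real.Gamma (m + 3 / 2) *
        ((2 * m + δ) * Real.Gamma (m + δ) / Real.Gamma (m + δ - 1 / 2)) := by
  have hd : (2 : ℝ) ≤ δ := by exact_mod_cast h
  have hm : (0 : ℝ) ≤ m := by positivity
  have h1 : 0 < Real.Gamma (m + 1) := Real.Gamma_pos_of_pos (by positivity)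
  have h2 : 0 < Real.Gamma (m + 3 / 2) := Real.Gamma_pos_of_pos (by positivity)
  have h3 : 0 < Real.Gamma (m + δ) := Real.Gamma_pos_of_pos (by positivity)
  have h4 : 0 < Real.Gamma (m + δ - 1 / 2) := Real.Gamma_pos_of_pos (by linarith)
  exact Real.sq_sqrt (by positivity)

theorem Model.normConst_pos (M : Model) {δ : ℕ} (h : M.Admissible δ) (m : ℕ) :
    0 < M.normConst δ m := by
  cases M
  · have hd : (2 : ℝ) ≤ δ := by exact_mod_cast (h : 2 ≤ δ)
    have hm : (0 : ℝ) ≤ m := by positivity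
    have h1 : 0 < Real.Gamma (m + 1) := Real.Gamma_pos_of_pos (by positivity)
    have h2 : 0 < Real.Gamma (m + 3 / 2) := Real.Gamma_pos_of_pos (by positivity)
    have h3 : 0 < Real.Gamma (m + δ) := Real.Gamma_pos_of_pos (by positivity)
    have h4 : 0 < Real.Gamma (m + δ - 1 / 2) := Real.Gamma_pos_of_pos (by linarith)
    exact Real.sqrt_pos.2 (by positivity)
  · exact Real.sqrt_pos.2 (by positivity)

theorem Model.normConst_sq_succ_KG {δ : ℕ} (h : 2 ≤ δ) (m : ℕ) :
    (m + 3 / 2) * (2 * m + δ) * (m + δ - 1 / 2) * Model.normConst .KG δ (m + 1) ^ 2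
      = (m + 1) * (2 * m + δ + 2) * (m + δ) * Model.normConst .KG δ m ^ 2 := by
  have hd : (2 : ℝ) ≤ δ := by exact_mod_cast h
  have hm : (0 : ℝ) ≤ m := by positivity
  rw [normConst_sq_KG h, normConst_sq_KG h]
  have h2 : Real.Gamma (m + 3 / 2) ≠ 0 := (Real.Gamma_pos_of_pos (by positivity)).ne'
  have h4 : Real.Gamma (m + δ - 1 / 2) ≠ 0 := (Real.Gamma_pos_of_pos (by linarith)).ne'
  have h5 : (m : ℝ) + δ - 1 / 2 ≠ 0 := by linarith
  have h6 : (m : ℝ) + 3 / 2 ≠ 0 := by positivity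
  push_cast
  rw [show (m : ℝ) + 1 + 3 / 2 = m + 3 / 2 + 1 by ring,
    show (m : ℝ) + 1 + δ = m + δ + 1 by ring,
    show (m : ℝ) + δ + 1 - 1 / 2 = m + δ - 1 / 2 + 1 by ring,
    Real.Gamma_add_one (s := (m : ℝ) + 1) (by positivity), Real.Gamma_add_one h6,
    Real.Gamma_add_one (s := (m : ℝ) + δ) (by positivity), Real.Gamma_add_one h5]
  generalize Real.Gamma (m + 3 / 2) = g2 at *
  generalize Real.Gamma (m + δ - 1 / 2) = g4 at *
  generalize Real.Gamma (m + δ) = g3 at *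
  generalize Real.Gamma (m + 1) = g1 at *
  generalize hu : (m : ℝ) + δ - 1 / 2 = u at *
  generalize hv : (m : ℝ) + 3 / 2 = v at *
  field_simp
  ring

theorem Model.normConst_sq_succ_WM (δ m : ℕ) :
    (m + δ + 1) * (2 * m + δ + 2) * (m + 2) * Model.normConst .WM δ (m + 1) ^ 2
      = (m + 1) * (2 * m + δ + 4) * (m + δ + 2) * Model.normConst .WM δ m ^ 2 := by
  rw [normConst, normConst, Real.sq_sqrt (by positivity), Real.sq_sqrt (by positivity)]
  push_cast
  field_simp
  ring

/-- `‖e_m‖` does not depend on `m`. Its value is not needed, since a common factor of the `e_m` does not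
affect the sign of the gap. -/
theorem Model.normConst_sq_mul (M : Model) {δ : ℕ} (h : M.Admissible δ) (m : ℕ) :
    M.normConst δ m ^ 2 * M.functional δ (M.jacobi δ m ^ 2)
      = M.normConst δ 0 ^ 2 * M.functional δ 1 := by
  induction m with
  | zero => rw [jacobi_zero, one_pow]
  | succ m ih =>
    rw [← ih]
    have hΛ := M.isJacobiFunctional h
    cases M
    · have hd : (2 : ℝ) ≤ δ := by exact_mod_cast (h : 2 ≤ δ)
      have h1 := normConst_sq_succ_KG h m
      have h2 := hΛ.norm_succ (by norm_num [jacobiA])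
        (by simp only [jacobiA, jacobiB]; linarith) m
      change _ * Model.functional _ _ (Model.jacobi _ δ (m + 1) ^ 2)
        = _ * Model.functional _ _ (Model.jacobi _ δ m ^ 2) at h2
      simp only [jacobiA, jacobiB] at h2
      generalize Model.functional _ _ (Model.jacobi _ δ (m + 1) ^ 2) = H' at *
      generalize Model.functional _ _ (Model.jacobi _ δ m ^ 2) = H at *
      generalize normConst _ δ m ^ 2 = N at *
      generalize normConst _ δ (m + 1) ^ 2 = N' at *
      have hm : (0 : ℝ) ≤ m := by positivity
      have p1 : (0 : ℝ) < m + δ - 1 / 2 := by linarith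
      have p : ((m : ℝ) + 3 / 2) * (2 * m + δ) * (m + δ - 1 / 2)
        * ((2 * m + δ + 2) * (m + 1) * (m + δ)) ≠ 0 := by positivity
      refine mul_left_cancel₀ p ?_
      linear_combination ((2 * m + δ + 2) * (m + 1) * (m + δ) * H') * h1
        + ((m + 1) * (2 * m + δ + 2) * (m + δ) * N) * h2
    · have h1 := normConst_sq_succ_WM δ m
      have h2 := hΛ.norm_succ (by simp only [jacobiA]; linarith [show (0 : ℝ) ≤ δ by positivity])
        (by simp only [jacobiA, jacobiB]; positivity) m
      change _ * Model.functional _ _ (Model.jacobi _ δ (m + 1) ^ 2)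
        = _ * Model.functional _ _ (Model.jacobi _ δ m ^ 2) at h2
      simp only [jacobiA, jacobiB] at h2
      generalize Model.functional _ _ (Model.jacobi _ δ (m + 1) ^ 2) = H' at *
      generalize Model.functional _ _ (Model.jacobi _ δ m ^ 2) = H at *
      generalize normConst _ δ m ^ 2 = N at *
      generalize normConst _ δ (m + 1) ^ 2 = N' at *
      have p : ((m : ℝ) + δ + 1) * (2 * m + δ + 2) * (m + 2)
        * ((2 * m + δ + 4) * (m + 1) * (m + δ + 2)) ≠ 0 := by positivity
      refine mul_left_cancel₀ p ?_
      linear_combination ((2 * m + δ + 4) * (m + 1) * (m + δ + 2) * H') * h1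
        + ((m + 1) * (2 * m + δ + 4) * (m + δ + 2) * N) * h2

theorem Model.gap_eq (M : Model) {δ : ℕ} (h : M.Admissible δ) : ∃ κ : ℝ, 0 < κ ∧ ∀ m,
    M.gap δ m = κ * (M.average δ 0 / M.omega δ 0 ^ 2
      - 2 * (M.average δ m / M.omega δ m ^ 2)) := by
  refine ⟨M.normConst δ 0 ^ 2 * (M.normConst δ 0 ^ 2 * M.functional δ 1),
    mul_pos (pow_pos (M.normConst_pos h 0) 2)
      (mul_pos (pow_pos (M.normConst_pos h 0) 2) (M.functional_one_pos δ)), fun m => ?_⟩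
  have key : ∀ m, M.fourierCoeff δ 0 0 m m
      = M.normConst δ 0 ^ 2 * (M.normConst δ 0 ^ 2 * M.functional δ 1) * M.average δ m := by
    intro m
    have := (M.functional_jacobi_sq_pos h m).ne'
    rw [M.fourierCoeff_eq h, ← M.normConst_sq_mul h m, average]
    field_simp
  rw [gap, key 0, key m]
  ring

/-! ### Averages of the weight in the Klein--Gordon model -/

theorem Model.average_KG_one {δ : ℕ} (h : 2 ≤ δ) :
    Model.average .KG δ 1 = (5 * δ ^ 2 - 2 * δ - 1) * (δ + 2) / (2 * δ * (4 * δ ^ 2 - 1))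
      * Model.average .KG δ 0 := by
  rw [average_zero]
  exact (Model.isJacobiFunctional .KG h).kg_ratio_one h (functional_one_pos .KG δ)

theorem Model.average_KG_two_lt {δ : ℕ} (h : 2 ≤ δ) :
    2 * Model.average .KG δ 2 * δ ^ 2 < Model.average .KG δ 0 * (4 + δ) ^ 2 := by
  rw [average_zero]
  exact (Model.isJacobiFunctional .KG h).kg_ratio_two h (functional_one_pos .KG δ)
    (functional_weightPoly_pos .KG δ)

theorem Model.average_KG_eq_newtonSum {δ : ℕ} (h : 2 ≤ δ) (m : ℕ) :
    Model.average .KG δ m = newtonSum (((δ - 1 : ℕ) : ℝ) * ((δ - 1 : ℕ) - 1))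
      ((2 * m + δ) ^ 2) (δ - 1) := by
  have hd : ((δ - 1 : ℕ) : ℝ) = δ - 1 := by rw [Nat.cast_sub (by omega)]; simp
  have key := (Model.isJacobiFunctional .KG h).map_one_sub_X_pow_mul m (δ - 1)
    (by rw [hd]; simp only [jacobiB]; linarith [show (0 : ℝ) ≤ m by positivity])
  have e1 : (jacobiB .KG δ ^ 2 - 1 / 4) = ((δ - 1 : ℕ) : ℝ) * ((δ - 1 : ℕ) - 1) := by
    rw [hd]; simp only [jacobiB]; ring
  have e2 : (2 * m + jacobiB .KG δ + 3 / 2) = 2 * (m : ℝ) + δ := by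
    simp only [jacobiB]; ring
  rw [e1, e2] at key
  rw [average, div_eq_iff (functional_jacobi_sq_pos .KG h m).ne']
  exact key

theorem Model.average_KG_anti {δ : ℕ} (h : 2 ≤ δ) {m m' : ℕ} (hm : m ≤ m') :
    Model.average .KG δ m' ≤ Model.average .KG δ m := by
  have hd : ((δ - 1 : ℕ) : ℝ) = δ - 1 := by rw [Nat.cast_sub (by omega)]; simp
  have : (m : ℝ) ≤ m' := by exact_mod_cast hm
  rw [average_KG_eq_newtonSum h, average_KG_eq_newtonSum h]
  refine newtonSum_anti ?_ ?_
  · rw [hd, sub_add_cancel]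
    gcongr
    linarith [show (0 : ℝ) ≤ m by positivity]
  · gcongr

theorem Model.average_KG_lt {δ m : ℕ} (h : 2 ≤ δ) (hm : 2 ≤ m) :
    2 * Model.average .KG δ m * δ ^ 2 < Model.average .KG δ 0 * (2 * m + δ) ^ 2 := by
  have hm' : (2 : ℝ) ≤ m := by exact_mod_cast hm
  have h0 := average_zero_pos .KG δ
  calc 2 * Model.average .KG δ m * δ ^ 2 ≤ 2 * Model.average .KG δ 2 * δ ^ 2 := by
        gcongr
        exact average_KG_anti h hm
    _ < Model.average .KG δ 0 * (4 + δ) ^ 2 := average_KG_two_lt h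
    _ ≤ Model.average .KG δ 0 * (2 * m + δ) ^ 2 := by
        gcongr
        linarith

/-- The sign of `10 δ² - δ³ - 2`, which changes between `9` and `10`, decides the case `m = 1`. -/
theorem Model.average_KG_one_sub {δ : ℕ} (h : 2 ≤ δ) :
    Model.average .KG δ 0 * (2 + δ) ^ 2 - 2 * Model.average .KG δ 1 * δ ^ 2
      = (δ + 2) / (4 * δ ^ 2 - 1) * Model.average .KG δ 0 * (10 * δ ^ 2 - δ ^ 3 - 2) := by
  have hd : (2 : ℝ) ≤ δ := by exact_mod_cast h
  have h1 : 4 * (δ : ℝ) ^ 2 - 1 ≠ 0 := by nlinarith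
  rw [average_KG_one h]
  generalize hD : 4 * (δ : ℝ) ^ 2 - 1 = D at *
  field_simp
  rw [← hD]
  ring

/-! ### Averages of the weight in the wave maps model -/

/-- The averages of `W` and of `t^δ` satisfy the hypotheses of `two_mul_lt_of_recurrence`. -/
theorem Model.average_WM {δ : ℕ} (h : 1 ≤ δ) (m : ℕ) :
    0 < Model.average .WM δ (m + 1) ∧ 2 * Model.average .WM δ (m + 1) * (δ + 2) ^ 2
      < Model.average .WM δ 0 * (2 * (m + 1) + δ + 2) ^ 2 := by
  obtain ⟨k, rfl⟩ : ∃ k, δ = k + 1 := ⟨δ - 1, by omega⟩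
  have hΛ : IsJacobiFunctional ((k + 1 : ℕ) : ℝ) 1 (functional .WM (k + 1)) :=
    Model.isJacobiFunctional .WM h
  have hd : ((k + 1 : ℕ) : ℝ) = k + 1 := by push_cast; ring
  have hpos := functional_jacobi_sq_pos .WM h
  have hnorm : ∀ m : ℕ, _ := fun m => hΛ.norm_succ
    (by rw [hd]; linarith [show (0 : ℝ) ≤ k by positivity]) (by positivity) m
  have hX := fun m : ℕ => hΛ.map_jacobiPoly_X_pow m k hd
  have hW := fun m : ℕ => hΛ.map_jacobiPoly_weight m k hd
  have t0 := hΛ.map_X_pow_succ k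
  have t1 := hΛ.map_X_pow_succ (k + 1)
  have hone := functional_one_pos .WM (k + 1)
  have hXpos : 0 < functional .WM (k + 1) (X ^ (k + 1)) :=
    functional_pos .WM _ fun t ht => by simpa using pow_pos ht.1 _
  change ∀ m : ℕ, _ * functional .WM (k + 1) (jacobi .WM (k + 1) (m + 1) ^ 2)
    = _ * functional .WM (k + 1) (jacobi .WM (k + 1) m ^ 2) at hnorm
  change ∀ m : ℕ, _ * functional .WM (k + 1) (jacobi .WM (k + 1) (m + 1) ^ 2 * _)
    = _ * functional .WM (k + 1) (jacobi .WM (k + 1) m ^ 2 * _) at hX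
  change ∀ m : ℕ, _ * functional .WM (k + 1) (jacobi .WM (k + 1) (m + 1) ^ 2 * _)
    = _ * functional .WM (k + 1) (jacobi .WM (k + 1) m ^ 2 * _)
      + _ * functional .WM (k + 1) (jacobi .WM (k + 1) m ^ 2 * _) at hW
  have hδ : (1 : ℝ) ≤ ((k + 1 : ℕ) : ℝ) := by exact_mod_cast h
  have hu : ∀ m, Model.average .WM (k + 1) m
      = functional .WM (k + 1) (jacobi .WM (k + 1) m ^ 2 * (X ^ k * (1 - X) ^ 2))
        / functional .WM (k + 1) (jacobi .WM (k + 1) m ^ 2) := fun m => rfl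
  rw [show (k : ℝ) = ((k + 1 : ℕ) : ℝ) - 1 by push_cast; ring] at t0
  rw [show ((k + 1 : ℕ) : ℝ) + 1 + ((k + 1 : ℕ) : ℝ) = 2 * ((k + 1 : ℕ) : ℝ) + 1 by ring] at t1
  clear hd hΛ
  generalize ((k + 1 : ℕ) : ℝ) = d at *
  refine two_mul_lt_of_recurrence hδ (u := Model.average .WM (k + 1))
    (n := fun m => functional .WM (k + 1) (jacobi .WM (k + 1) m ^ 2 * X ^ (k + 1))
      / functional .WM (k + 1) (jacobi .WM (k + 1) m ^ 2)) ?_ ?_ ?_ ?_ m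
  · rw [hu]
    simp only [jacobi_zero, one_pow, one_mul]
    rw [← mul_div_assoc, ← mul_div_assoc]
    congr 1
    rw [show (X ^ k * (1 - X) ^ 2 : ℝ[X]) = X ^ k - C 2 * X ^ (k + 1) + X ^ (k + 1 + 1) by
      rw [map_ofNat]; ring, map_add, map_sub, map_C_mul]
    linear_combination -(2 * d + 3) / 2 * t0 + d * t1
  · simp only [jacobi_zero, one_pow, one_mul]
    positivity
  · intro m
    have h1 := hpos m
    have h2 := hpos (m + 1)
    have h3 := hnorm m
    have h4 := hX m
    generalize functional .WM (k + 1) (jacobi .WM (k + 1) (m + 1) ^ 2) = H' at *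
    generalize functional .WM (k + 1) (jacobi .WM (k + 1) m ^ 2) = H at *
    rw [← mul_div_assoc, ← mul_div_assoc, div_eq_div_iff h2.ne' h1.ne']
    have p : ((m : ℝ) + 1) * (m + d + 2) * (m + d + 1) ≠ 0 := by positivity
    refine mul_left_cancel₀ p ?_
    linear_combination ((2 * m + d + 2) * (m + 2) * (m + d + 1) * H) * h4
      - ((m + d + 1) ^ 2 * (2 * m + 3)
        * functional .WM (k + 1) (jacobi .WM (k + 1) m ^ 2 * X ^ (k + 1))) * h3
  · intro m
    have h1 := hpos m
    have h2 := hpos (m + 1)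
    have h3 := hnorm m
    have h4 := hW m
    rw [hu, hu]
    generalize functional .WM (k + 1) (jacobi .WM (k + 1) (m + 1) ^ 2) = H' at *
    generalize functional .WM (k + 1) (jacobi .WM (k + 1) m ^ 2) = H at *
    generalize functional .WM (k + 1) (jacobi .WM (k + 1) (m + 1) ^ 2 * _) = Y' at *
    generalize functional .WM (k + 1) (jacobi .WM (k + 1) m ^ 2 * (X ^ k * _)) = Y at *
    generalize functional .WM (k + 1) (jacobi .WM (k + 1) m ^ 2 * _) = N at *
    have e1 : H' = (m + d + 1) * (m + 2) * (2 * m + d + 2)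
        / ((m + 1) * (m + d + 2) * (2 * m + d + 4)) * H := by
      rw [div_mul_eq_mul_div, eq_div_iff (by positivity)]
      linear_combination h3
    have e2 : Y' = ((m + 2) ^ 2 / (m + d + 2) ^ 2) * Y
        + ((m + 2) * (m + d + 1) * (2 * m + d + 3)
          * (3 * ((2 * m + 1) * d + 2 * m ^ 2 + 6 * m + 3)))
          / ((d + 1) * (2 * m + 1) * (2 * d + 2 * m + 3) * (2 * d + 2 * m + 5) * (m + 1)
            * (m + d + 2) ^ 2) * N := by
      have p : (d + 1) * (2 * m + 1) * (2 * d + 2 * m + 3) * (2 * d + 2 * m + 5) * (m + 1)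
        * (m + d + 2) ^ 2 ≠ 0 := by positivity
      refine mul_left_cancel₀ p ?_
      rw [h4]
      field_simp
    rw [e1, e2]
    field_simp
    ring

/-! ### Sign and minimum of the gap -/

theorem Model.omega_pos (M : Model) {δ : ℕ} (h : M.Admissible δ) (m : ℕ) :
    0 < M.omega δ m := by
  cases M
  · have : (2 : ℝ) ≤ δ := by exact_mod_cast (h : 2 ≤ δ)
    simp only [omega]
    positivity
  · simp only [omega]
    positivity

theorem Model.gap_eq_mul_sub (M : Model) {δ : ℕ} (h : M.Admissible δ) (m : ℕ) : ∃ κ : ℝ, 0 < κ ∧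
    M.gap δ m = κ * (M.average δ 0 * M.omega δ m ^ 2
      - 2 * M.average δ m * M.omega δ 0 ^ 2) := by
  obtain ⟨κ, hκ, H⟩ := M.gap_eq h
  have h0 := M.omega_pos h 0
  have hm := M.omega_pos h m
  refine ⟨κ / (M.omega δ 0 ^ 2 * M.omega δ m ^ 2), by positivity, ?_⟩
  rw [H]
  field_simp

theorem Model.gap_pos_of_lt (M : Model) {δ : ℕ} (h : M.Admissible δ) {m : ℕ}
    (hlt : 2 * M.average δ m * M.omega δ 0 ^ 2 < M.average δ 0 * M.omega δ m ^ 2) :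
    0 < M.gap δ m := by
  obtain ⟨κ, hκ, H⟩ := M.gap_eq_mul_sub h m
  rw [H]
  exact mul_pos hκ (sub_pos.2 hlt)

theorem Model.gap_WM_pos {δ m : ℕ} (h : 1 ≤ δ) (hm : 1 ≤ m) : 0 < Model.gap .WM δ m := by
  obtain ⟨k, rfl⟩ : ∃ k, m = k + 1 := ⟨m - 1, by omega⟩
  refine Model.gap_pos_of_lt .WM h ?_
  have := (Model.average_WM h k).2
  simp only [omega]
  push_cast
  rwa [mul_zero, zero_add]

theorem Model.gap_KG_pos_of_two_le {δ m : ℕ} (h : 2 ≤ δ) (hm : 2 ≤ m) :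
    0 < Model.gap .KG δ m := by
  refine Model.gap_pos_of_lt .KG h ?_
  have := Model.average_KG_lt h hm
  simp only [omega]
  push_cast
  rwa [mul_zero, zero_add]

theorem Model.gap_KG_one {δ : ℕ} (h : 2 ≤ δ) : ∃ κ : ℝ, 0 < κ ∧
    Model.gap .KG δ 1 = κ * (10 * δ ^ 2 - δ ^ 3 - 2) := by
  obtain ⟨κ, hκ, H⟩ := Model.gap_eq_mul_sub .KG h 1
  have hd : (2 : ℝ) ≤ δ := by exact_mod_cast h
  have h1 : 0 < 4 * (δ : ℝ) ^ 2 - 1 := by nlinarith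
  have h0 := average_zero_pos .KG δ
  refine ⟨κ * ((δ + 2) / (4 * δ ^ 2 - 1) * Model.average .KG δ 0), by positivity, ?_⟩
  rw [H, mul_assoc κ (_ / _ * _), ← average_KG_one_sub h]
  simp only [omega]
  push_cast
  ring

theorem Model.gap_KG_one_pos {δ : ℕ} (h : 2 ≤ δ) (h9 : δ ≤ 9) : 0 < Model.gap .KG δ 1 := by
  obtain ⟨κ, hκ, H⟩ := Model.gap_KG_one h
  have hd : (2 : ℝ) ≤ δ := by exact_mod_cast h
  have hd9 : (δ : ℝ) ≤ 9 := by exact_mod_cast h9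
  rw [H]
  exact mul_pos hκ (by nlinarith [sq_nonneg (δ : ℝ)])

theorem Model.gap_KG_one_neg {δ : ℕ} (h : 10 ≤ δ) : Model.gap .KG δ 1 < 0 := by
  obtain ⟨κ, hκ, H⟩ := Model.gap_KG_one (show 2 ≤ δ by omega)
  have hd : (10 : ℝ) ≤ δ := by exact_mod_cast h
  rw [H]
  exact mul_neg_of_pos_of_neg hκ (by nlinarith [sq_nonneg (δ : ℝ)])

theorem Model.gap_ne_zero (M : Model) {δ m : ℕ} (h : M.Admissible δ) (hm : 1 ≤ m) :
    M.gap δ m ≠ 0 := by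
  cases M
  · rcases hm.lt_or_eq with hm | rfl
    · exact (gap_KG_pos_of_two_le h hm).ne'
    · rcases le_or_gt δ 9 with h9 | h9
      · exact (gap_KG_one_pos h h9).ne'
      · exact (gap_KG_one_neg h9).ne
  · exact (gap_WM_pos h hm).ne'

theorem Model.gap_pos (M : Model) {δ m : ℕ} (h : M.StableMass δ) (hm : 1 ≤ m) :
    0 < M.gap δ m := by
  cases M
  · rcases hm.lt_or_eq with hm | rfl
    · exact gap_KG_pos_of_two_le h.1 hm
    · exact gap_KG_one_pos h.1 h.2
  · exact gap_WM_pos h hm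

theorem Model.average_one_pos (M : Model) {δ : ℕ} (h : M.Admissible δ) : 0 < M.average δ 1 := by
  cases M
  · have hd : (2 : ℝ) ≤ δ := by exact_mod_cast (h : 2 ≤ δ)
    have h1 : 0 < 4 * (δ : ℝ) ^ 2 - 1 := by nlinarith
    have h2 : 0 < 5 * (δ : ℝ) ^ 2 - 2 * δ - 1 := by nlinarith
    have h0 := average_zero_pos .KG δ
    rw [average_KG_one h]
    positivity
  · exact (average_WM h 0).1

theorem Model.tendsto_gap (M : Model) {δ : ℕ} (h : M.Admissible δ) :
    ∃ L : ℝ, M.gap δ 1 < L ∧ Filter.Tendsto (M.gap δ) Filter.atTop (nhds L) := by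
  obtain ⟨κ, hκ, H⟩ := M.gap_eq h
  refine ⟨κ * (M.average δ 0 / M.omega δ 0 ^ 2), ?_, ?_⟩
  · rw [H]
    have h1 := M.average_one_pos h
    have h2 := M.omega_pos h 1
    have h3 : 0 < 2 * (M.average δ 1 / M.omega δ 1 ^ 2) := by positivity
    exact mul_lt_mul_of_pos_left (by linarith) hκ
  · have hω : Filter.Tendsto (fun m : ℕ => M.omega δ m ^ 2) Filter.atTop Filter.atTop := by
      refine Filter.tendsto_atTop_mono (fun m => ?_) tendsto_natCast_atTop_atTop
      have hm : (m : ℝ) ≤ m ^ 2 := by exact_mod_cast Nat.le_self_pow two_ne_zero m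
      refine hm.trans (pow_le_pow_left₀ (by positivity) ?_ 2)
      have : (0 : ℝ) ≤ m := by positivity
      have : (0 : ℝ) ≤ δ := by positivity
      cases M <;> simp only [omega] <;> linarith
    have h0 : Filter.Tendsto (fun m => M.average δ m / M.omega δ m ^ 2) Filter.atTop (nhds 0) := by
      refine squeeze_zero (fun m => ?_) (fun m => ?_) hω.inv_tendsto_atTop
      · exact div_nonneg (M.average_nonneg δ m) (sq_nonneg _)
      · rw [Pi.inv_apply, ← one_div]
        exact div_le_div_of_nonneg_right (M.average_le_one h m) (sq_nonneg _)
    have := ((h0.const_mul 2).const_sub (M.average δ 0 / M.omega δ 0 ^ 2)).const_mul κ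
    rw [mul_zero, sub_zero] at this
    exact this.congr fun m => (H m).symm

/-- The gaps converge to a limit above the first gap, so only finitely many of them can be smaller than
the first one. -/
theorem Model.exists_isLeast_gapSet (M : Model) {δ : ℕ} (h : M.Admissible δ) :
    ∃ r, IsLeast (M.gapSet δ) r := by
  obtain ⟨L, hL, hlim⟩ := M.tendsto_gap h
  obtain ⟨K, hK⟩ := Filter.eventually_atTop.1 (hlim.eventually_const_lt hL)
  obtain ⟨m₀, hm₀, hmin⟩ := (Finset.Icc 1 (K + 1)).exists_min_image (M.gap δ) ⟨1, by simp⟩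
  refine ⟨M.gap δ m₀, ⟨m₀, (Finset.mem_Icc.1 hm₀).1, rfl⟩, ?_⟩
  rintro _ ⟨m, hm, rfl⟩
  rcases le_or_gt m (K + 1) with hmK | hmK
  · exact hmin m (Finset.mem_Icc.2 ⟨hm, hmK⟩)
  · exact (hmin 1 (by simp)).trans (hK m (by omega)).le

end

end AdS

theorem mainTheorem3 :
    (∀ (M : AdS.Model) (δ : ℕ), M.Admissible δ → ∀ m : ℕ, 1 ≤ m → M.gap δ m ≠ 0) ∧
    (∀ (M : AdS.Model) (δ : ℕ), M.Admissible δ →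
      (M.gapSet δ ⊆ Set.Ioi 0 ↔ M.StableMass δ)) ∧
    (∀ (M : AdS.Model) (δ : ℕ), M.Admissible δ → M.StableMass δ →
      ∃ c : ℝ, 0 < c ∧ ∃ r : ℝ, IsLeast (M.gapSet δ) r ∧ c ≤ r) := by
  refine ⟨fun M δ h m hm => M.gap_ne_zero h hm, fun M δ h => ⟨fun hsub => ?_, ?_⟩,
    fun M δ h hs => ?_⟩
  · cases M
    · refine ⟨h, ?_⟩
      by_contra! h9
      exact lt_asymm (AdS.Model.gap_KG_one_neg h9) (hsub ⟨1, le_rfl, rfl⟩)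
    · exact h
  · rintro hs _ ⟨m, hm, rfl⟩
    exact M.gap_pos hs hm
  · obtain ⟨r, hr⟩ := M.exists_isLeast_gapSet h
    obtain ⟨m, hm, rfl⟩ := hr.1
    exact ⟨M.gap δ m, M.gap_pos hs hm, _, hr, le_rfl⟩
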